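/- Consider instances consisting of $n\ge 1$ unit-length closed intervals $I_i=[x_i,x_i+1]$ $(1\le i\le n)$ on the real line, given in sorted order $x_1\le\dots\le x_n$ of their left endpoints, where each interval has one of $k$ colors. A realization chooses one point $r_i\in I_i$ for every $i$. A color-spanning interval of a realization is a closed interval that contains, for each of the $k$ colors, a chosen point $r_i$ of an interval $I_i$ of that color; a minimum color-spanning interval (MCSI) is a color-spanning interval of minimum length. The problem L-MCSI asks for a realization whose MCSI is as long as possible. Theorem. If no two intervals of distinct colors intersect (intervals of the same color may overlap), then L-MCSI can be solved in $O(n)$ time. That is, there are a real-RAM program and a constant $C$, both independent of $n$, $k$ and the instance, such that on every such instance the program halts after at most $C\,n$ steps and outputs a realization that solves L-MCSI. (The real RAM performs the four arithmetic operations and comparisons on real numbers, without rounding, and addition, subtraction, comparison and array indexing on natural numbers, at unit cost. If some color is not used, there are no color-spanning intervals and every realization counts as a solution.) -/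

import Mathlib

/-! ### The real RAM

A random access machine with unit-cost operations. Its memory consists of arrays of natural numbers
(used as indices, counters and colors) and of arrays of real numbers. Natural numbers can be
added, subtracted and compared; real numbers can be added, subtracted, multiplied, divided and
compared; natural numbers can be converted to reals. There is no rounding, and only rational
constants may occur in a program. A program is a fixed finite text, so that it names only finitely
many arrays; every array access is by a computed index. Each elementary operation, memory access,
test and assignment costs one step. -/

namespace RealRAM

/-- Contents of the memory: `nat a i` and `real a i` are the cells with index `i` of
the `a`-th array of natural numbers and of the `a`-th array of real numbers. -/
structure Memory where
  nat : ℕ → ℕ → ℕ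
  real : ℕ → ℕ → ℝ

/-- Overwrite one natural number cell. -/
def Memory.setNat (m : Memory) (a i v : ℕ) : Memory :=
  { m with nat := Function.update m.nat a (Function.update (m.nat a) i v) }

/-- Overwrite one real number cell. -/
noncomputable def Memory.setReal (m : Memory) (a i : ℕ) (v : ℝ) : Memory :=
  { m with real := Function.update m.real a (Function.update (m.real a) i v) }

/-- Expressions of natural number type; `get a e` reads the cell of array `a` at index `e`. -/
inductive NatExpr where
  | const (c : ℕ)
  | get (a : ℕ) (e : NatExpr)
  | add (e f : NatExpr)
  | sub (e f : NatExpr)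

/-- Value of an expression (subtraction is truncated at zero). -/
def NatExpr.eval (m : Memory) : NatExpr → ℕ
  | const c => c
  | get a e => m.nat a (e.eval m)
  | add e f => e.eval m + f.eval m
  | sub e f => e.eval m - f.eval m

/-- Number of operations performed by the evaluation of an expression. -/
def NatExpr.cost : NatExpr → ℕ
  | const _ => 1
  | get _ e => e.cost + 1
  | add e f => e.cost + f.cost + 1
  | sub e f => e.cost + f.cost + 1

/-- Expressions of real number type. -/
inductive RealExpr where
  | const (c : ℚ)
  | get (a : ℕ) (e : NatExpr)
  | ofNat (e : NatExpr)
  | add (e f : RealExpr)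
  | sub (e f : RealExpr)
  | mul (e f : RealExpr)
  | div (e f : RealExpr)

/-- Value of an expression (division by zero gives zero, which a program could also
achieve by a test). -/
noncomputable def RealExpr.eval (m : Memory) : RealExpr → ℝ
  | const c => (c : ℝ)
  | get a e => m.real a (e.eval m)
  | ofNat e => (e.eval m : ℝ)
  | add e f => e.eval m + f.eval m
  | sub e f => e.eval m - f.eval m
  | mul e f => e.eval m * f.eval m
  | div e f => e.eval m / f.eval m

/-- Number of operations performed by the evaluation of an expression. -/
def RealExpr.cost : RealExpr → ℕ
  | const _ => 1
  | get _ e => e.cost + 1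
  | ofNat e => e.cost + 1
  | add e f => e.cost + f.cost + 1
  | sub e f => e.cost + f.cost + 1
  | mul e f => e.cost + f.cost + 1
  | div e f => e.cost + f.cost + 1

/-- Tests. -/
inductive Test where
  | natLt (e f : NatExpr)
  | natEq (e f : NatExpr)
  | realLt (e f : RealExpr)
  | neg (b : Test)
  | both (b c : Test)

/-- The test succeeds in the given memory. -/
def Test.Holds (m : Memory) : Test → Prop
  | natLt e f => e.eval m < f.eval m
  | natEq e f => e.eval m = f.eval m
  | realLt e f => e.eval m < f.eval m
  | neg b => ¬ b.Holds m
  | both b c => b.Holds m ∧ c.Holds m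

/-- Number of operations performed by a test. -/
def Test.cost : Test → ℕ
  | natLt e f => e.cost + f.cost + 1
  | natEq e f => e.cost + f.cost + 1
  | realLt e f => e.cost + f.cost + 1
  | neg b => b.cost + 1
  | both b c => b.cost + c.cost + 1

/-- Programs. `setNat a i e` and `setReal a i e` assign the value of `e` to the cell with
index `i` of array `a`. -/
inductive Program where
  | skip
  | setNat (a : ℕ) (i e : NatExpr)
  | setReal (a : ℕ) (i : NatExpr) (e : RealExpr)
  | seq (p q : Program)
  | ite (b : Test) (p q : Program)
  | while (b : Test) (p : Program)

/-- `Runs p m t m'`: started in memory `m`, the program `p` halts after exactly `t` steps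
with memory `m'`. -/
inductive Runs : Program → Memory → ℕ → Memory → Prop
  | skip (m : Memory) : Runs Program.skip m 1 m
  | setNat (m : Memory) (a : ℕ) (i e : NatExpr) :
      Runs (Program.setNat a i e) m (i.cost + e.cost + 1) (m.setNat a (i.eval m) (e.eval m))
  | setReal (m : Memory) (a : ℕ) (i : NatExpr) (e : RealExpr) :
      Runs (Program.setReal a i e) m (i.cost + e.cost + 1) (m.setReal a (i.eval m) (e.eval m))
  | seq {p q : Program} {m m' m'' : Memory} {s t : ℕ} (hp : Runs p m s m')
      (hq : Runs q m' t m'') : Runs (Program.seq p q) m (s + t) m''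
  | ite_true {b : Test} {p q : Program} {m m' : Memory} {t : ℕ} (hb : b.Holds m)
      (hp : Runs p m t m') : Runs (Program.ite b p q) m (b.cost + 1 + t) m'
  | ite_false {b : Test} {p q : Program} {m m' : Memory} {t : ℕ} (hb : ¬ b.Holds m)
      (hq : Runs q m t m') : Runs (Program.ite b p q) m (b.cost + 1 + t) m'
  | while_true {b : Test} {p : Program} {m m' m'' : Memory} {s t : ℕ} (hb : b.Holds m)
      (hp : Runs p m s m') (hw : Runs (Program.while b p) m' t m'') :
      Runs (Program.while b p) m (b.cost + 1 + s + t) m''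
  | while_false {b : Test} {p : Program} {m : Memory} (hb : ¬ b.Holds m) :
      Runs (Program.while b p) m (b.cost + 1) m

end RealRAM

/-! ### Largest minimum color-spanning intervals

An instance consists of `n` unit intervals `[x i, x i + 1]`, where `col i`, one
of `k` colors, is the color of the `i`-th interval. -/

namespace LMCSI

/-- The unit interval with left endpoint `a`. -/
def unitSeg (a : ℝ) : Set ℝ := Set.Icc a (a + 1)

/-- A realization chooses one point, the representative, in each interval. -/
def IsRealization {n : ℕ} (x r : Fin n → ℝ) : Prop := ∀ i, r i ∈ unitSeg (x i)

/-- The interval `[a, b]` contains a representative of each of the `k` colors. -/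
def IsColorSpanning {n k : ℕ} (col : Fin n → Fin k) (r : Fin n → ℝ) (a b : ℝ) : Prop :=
  a ≤ b ∧ ∀ c : Fin k, ∃ i, col i = c ∧ r i ∈ Set.Icc a b

/-- `[a, b]` is a minimum color-spanning interval of `r`: one of minimum length. -/
def IsMCSI {n k : ℕ} (col : Fin n → Fin k) (r : Fin n → ℝ) (a b : ℝ) : Prop :=
  IsColorSpanning col r a b ∧ ∀ a' b', IsColorSpanning col r a' b' → b - a ≤ b' - a'

/-- `r` is a realization whose minimum color-spanning interval is as large as possible.
(If every color occurs, then every realization has a minimum color-spanning interval, see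
`exists_isMCSI`. If some color does not occur, there are no color-spanning intervals, and
every realization counts as a solution.) -/
def IsSolution {n k : ℕ} (x : Fin n → ℝ) (col : Fin n → Fin k) (r : Fin n → ℝ) : Prop :=
  IsRealization x r ∧ ∀ r', IsRealization x r' → ∀ a' b', IsMCSI col r' a' b' →
    ∃ a b, IsMCSI col r a b ∧ b' - a' ≤ b - a

theorem exists_isMCSI {n k : ℕ} (col : Fin n → Fin k) (hcol : Function.Surjective col)
    (r : Fin n → ℝ) : ∃ a b, IsMCSI col r a b := by
  rcases Nat.eq_zero_or_pos k with rfl | hk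
  · exact ⟨0, 0, ⟨le_rfl, fun c => c.elim0⟩, fun a' b' h => by linarith [h.1]⟩
  choose g hg using hcol
  have : Nonempty (Fin k) := ⟨⟨0, hk⟩⟩
  -- every choice of one representative per color has a smallest and a largest point
  have key : ∀ f : Fin k → Fin n, ∃ p q : Fin k,
      (∀ c, r (f p) ≤ r (f c)) ∧ ∀ c, r (f c) ≤ r (f q) := fun f => by
    obtain ⟨p, hp⟩ := Finite.exists_min (fun c => r (f c))
    obtain ⟨q, hq⟩ := Finite.exists_max (fun c => r (f c))
    exact ⟨p, q, hp, hq⟩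
  obtain ⟨p, q, hp, hq⟩ := key g
  let S : Set (Fin n × Fin n) := {z | IsColorSpanning col r (r z.1) (r z.2)}
  have hS : S.Nonempty := ⟨(g p, g q), hp q, fun c => ⟨g c, hg c, hp c, hq c⟩⟩
  obtain ⟨z, hz, hmin⟩ := S.toFinite.exists_minimalFor (fun z => r z.2 - r z.1) S hS
  refine ⟨r z.1, r z.2, hz, fun a' b' h => ?_⟩
  choose f hf using h.2
  obtain ⟨p', q', hp', hq'⟩ := key f
  have hw : (f p', f q') ∈ S := ⟨hp' q', fun c => ⟨f c, (hf c).1, hp' c, hq' c⟩⟩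
  have h1 := (hf p').2.1
  have h2 := (hf q').2.2
  rcases le_total (r z.2 - r z.1) (r (f q') - r (f p')) with h3 | h3
  · linarith
  · have h4 : r z.2 - r z.1 ≤ r (f q') - r (f p') := hmin hw h3
    linarith

/-- The input of the machine: `n` and `k` are in the first two cells of the natural number
array `0`, the colors are in the natural number array `1`, the left endpoints are in the real number
array `0`, and all other cells are zero. -/
noncomputable def input {n k : ℕ} (x : Fin n → ℝ) (col : Fin n → Fin k) : RealRAM.Memory where
  nat a i :=
    if a = 0 ∧ i = 0 then n
    else if a = 0 ∧ i = 1 then k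
    else if h : a = 1 ∧ i < n then (col ⟨i, h.2⟩ : ℕ)
    else 0
  real a i := if h : a = 0 ∧ i < n then x ⟨i, h.2⟩ else 0

/-- The output of the machine: the first `n` cells of the real number array `1`. -/
def output (n : ℕ) (m : RealRAM.Memory) : Fin n → ℝ := fun i => m.real 1 i

end LMCSI

/-!
A *run* is a maximal block of consecutive intervals of one color. Representatives of different runs
are sorted like the runs, so a minimum color-spanning interval leads from the last representative of
a run `v` to the first one of a run `w`, where the intervals from `v` to `w` form a window that
contains all colors and cannot be shortened on either side. Such runs are *linked*. Each run is the
left end of at most one link and the right end of at most one link, hence the links form disjoint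
paths. A realization is given by one position per run, which is at least the left endpoint `l` of
the last interval of the run: the intervals of the run are represented by this position, or by
their right endpoints where these are smaller. Only the right endpoint `u` of the first interval
matters in addition, and the minimum color-spanning interval has length at least `L` if all links
have gap at least `L`. For any realization, summing gaps along a path shows that the length of the
minimum color-spanning interval is at most `(u j - l i) / (j - i)` for all positions `i < j` on the
path. Conversely, if `L` is at most all these ratios, then the greedy placement
`max (l j) (previous position + L)` has gaps `L` (`Feasible.greedy_add_le`). So the optimum is
determined by the smallest of these ratios. The paths are concatenated, each of them
shifted far to the right of its predecessor, so that just one sequence has to be considered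
(`PathOrder`, `Separated.feasible_of_spans`, `Separated.le_of_spans`).

The smallest ratio is found in linear time because the current bound `L` only decreases: the indices
`i` that can still be critical are vertices of the upper hull of the points `(i, l i)`, the
critical one moves to the right along the hull, and new points are appended at its right end. So
the hull is kept in an array that shrinks at both ends and grows at the right end only (`Hull`).

The links are found by a window that moves over the intervals (`Links`). The program consists of
simple loops; `Program.wp` computes the preconditions of their bodies, and the loop rule
`exists_runs_while` bounds the number of rounds by an amortizing potential.
-/

/-! ### Straight-line code and loops -/

namespace RealRAM

/-- Weakest precondition of a loop-free program: it ends in a memory satisfying `Q`. Loops are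
excluded by giving them the precondition `False`. -/
def Program.wp : Program → (Memory → Prop) → Memory → Prop
  | skip, Q, m => Q m
  | setNat a i e, Q, m => Q (m.setNat a (i.eval m) (e.eval m))
  | setReal a i e, Q, m => Q (m.setReal a (i.eval m) (e.eval m))
  | seq p q, Q, m => p.wp (fun m' => q.wp Q m') m
  | ite b p q, Q, m => (b.Holds m → p.wp Q m) ∧ (¬ b.Holds m → q.wp Q m)
  | .while _ _, _, _ => False

/-- An upper bound for the number of steps of a loop-free program. -/
def Program.bound : Program → ℕ
  | skip => 1
  | setNat _ i e => i.cost + e.cost + 1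
  | setReal _ i e => i.cost + e.cost + 1
  | seq p q => p.bound + q.bound
  | ite b p q => b.cost + 1 + (p.bound + q.bound)
  | .while _ _ => 0

theorem Program.wp.exists_runs {p : Program} {Q : Memory → Prop} {m : Memory} (h : p.wp Q m) :
    ∃ t m', Runs p m t m' ∧ t ≤ p.bound ∧ Q m' := by
  induction p generalizing Q m with
  | skip => exact ⟨_, _, Runs.skip m, le_rfl, h⟩
  | setNat a i e => exact ⟨_, _, Runs.setNat m a i e, le_rfl, h⟩
  | setReal a i e => exact ⟨_, _, Runs.setReal m a i e, le_rfl, h⟩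
  | seq p q ihp ihq =>
    obtain ⟨s, m₁, hp, hs, h₁⟩ := ihp h
    obtain ⟨t, m₂, hq, ht, h₂⟩ := ihq h₁
    exact ⟨_, _, hp.seq hq, Nat.add_le_add hs ht, h₂⟩
  | ite b p q ihp ihq =>
    by_cases hb : b.Holds m
    · obtain ⟨t, m', hp, ht, h'⟩ := ihp (h.1 hb)
      exact ⟨_, _, hp.ite_true hb, by simp only [Program.bound]; omega, h'⟩
    · obtain ⟨t, m', hq, ht, h'⟩ := ihq (h.2 hb)
      exact ⟨_, _, hq.ite_false hb, by simp only [Program.bound]; omega, h'⟩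
  | _ => exact h.elim

/-- Loop rule: the invariant `Inv` gives partial correctness, and the potential `φ`, which drops in
every round, bounds the number of rounds. -/
theorem exists_runs_while {b : Test} {p : Program} (Inv : Memory → Prop) (φ : Memory → ℕ)
    (hstep : ∀ m, Inv m → b.Holds m → p.wp (fun m' => Inv m' ∧ φ m' < φ m) m)
    {m : Memory} (hm : Inv m) :
    ∃ t m', Runs (.while b p) m t m' ∧ t ≤ (φ m + 1) * (b.cost + 1 + p.bound) ∧
      Inv m' ∧ ¬ b.Holds m' := by
  induction hN : φ m using Nat.strong_induction_on generalizing m with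
  | _ N ih =>
    by_cases hb : b.Holds m
    · obtain ⟨s, m₁, hp, hs, h₁, hφ⟩ := (hstep m hm hb).exists_runs
      obtain ⟨t, m₂, hw, ht, h₂⟩ := ih (φ m₁) (hN ▸ hφ) h₁ rfl
      refine ⟨_, _, hp.while_true hb hw, ?_, h₂⟩
      have : (φ m₁ + 1) * (b.cost + 1 + p.bound) ≤ N * (b.cost + 1 + p.bound) :=
        Nat.mul_le_mul_right _ (by omega)
      rw [Nat.add_mul]
      omega
    · refine ⟨_, _, Runs.while_false hb, ?_, hm, hb⟩
      nlinarith [Nat.zero_le (N * (b.cost + 1 + p.bound)), Nat.zero_le p.bound]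

/-- The program assigns to some cell of the natural number array `a`. -/
def Program.WritesNat (a : ℕ) : Program → Prop
  | skip => False
  | setNat a' _ _ => a = a'
  | setReal _ _ _ => False
  | seq p q => p.WritesNat a ∨ q.WritesNat a
  | ite _ p q => p.WritesNat a ∨ q.WritesNat a
  | .while _ p => p.WritesNat a

/-- The program assigns to some cell of the real number array `a`. -/
def Program.WritesReal (a : ℕ) : Program → Prop
  | skip => False
  | setNat _ _ _ => False
  | setReal a' _ _ => a = a'
  | seq p q => p.WritesReal a ∨ q.WritesReal a
  | ite _ p q => p.WritesReal a ∨ q.WritesReal a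
  | .while _ p => p.WritesReal a

theorem Runs.nat_eq {p : Program} {m m' : Memory} {t : ℕ} (h : Runs p m t m') {a : ℕ}
    (ha : ¬ p.WritesNat a) : m'.nat a = m.nat a := by
  induction h with
  | skip => rfl
  | setNat m a' i e => exact Function.update_of_ne ha _ _
  | setReal => rfl
  | seq _ _ ih₁ ih₂ =>
    simp only [Program.WritesNat, not_or] at ha
    rw [ih₂ ha.2, ih₁ ha.1]
  | ite_true _ _ ih => simp only [Program.WritesNat, not_or] at ha; exact ih ha.1
  | ite_false _ _ ih => simp only [Program.WritesNat, not_or] at ha; exact ih ha.2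
  | while_true _ _ _ ih₁ ih₂ => rw [ih₂ ha, ih₁ ha]
  | while_false => rfl

theorem Runs.real_eq {p : Program} {m m' : Memory} {t : ℕ} (h : Runs p m t m') {a : ℕ}
    (ha : ¬ p.WritesReal a) : m'.real a = m.real a := by
  induction h with
  | skip => rfl
  | setNat => rfl
  | setReal m a' i e => exact Function.update_of_ne ha _ _
  | seq _ _ ih₁ ih₂ =>
    simp only [Program.WritesReal, not_or] at ha
    rw [ih₂ ha.2, ih₁ ha.1]
  | ite_true _ _ ih => simp only [Program.WritesReal, not_or] at ha; exact ih ha.1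
  | ite_false _ _ ih => simp only [Program.WritesReal, not_or] at ha; exact ih ha.2
  | while_true _ _ _ ih₁ ih₂ => rw [ih₂ ha, ih₁ ha]
  | while_false => rfl

/-- A natural number variable: cell `0` of the array `a`. -/
def nvar (a : ℕ) : NatExpr := .get a (.const 0)

/-- A real variable: cell `0` of the array `a`. -/
def rvar (a : ℕ) : RealExpr := .get a (.const 0)

/-- Cell of the natural number array `a` indexed by the variable `i`. -/
def natAt (a i : ℕ) : NatExpr := .get a (nvar i)

/-- Cell of the real number array `a` indexed by the variable `i`. -/
def realAt (a i : ℕ) : RealExpr := .get a (.get i (.const 0))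

/-- The assignment that increments a natural number variable. -/
def incr (a : ℕ) : Program := .setNat a (.const 0) (.add (nvar a) (.const 1))

/-- The disjunction of two tests. -/
def Test.or (b c : Test) : Test := .neg (.both (.neg b) (.neg c))

theorem Test.holds_or {b c : Test} {m : Memory} :
    (b.or c).Holds m ↔ b.Holds m ∨ c.Holds m := by
  simp only [Test.or, Test.Holds]; tauto

end RealRAM

/-! ### Spreading a sequence of points by an upper hull -/

namespace LMCSI

open RealRAM

/-- The gap `L` can be kept between consecutive points at positions `< n`, when the point at
position `i` must lie to the right of `l i` and to the left of `u i` (see `greedy`). -/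
def Feasible (l u : ℕ → ℝ) (n : ℕ) (L : ℝ) : Prop :=
  ∀ i j, i < j → j < n → l i + ((j : ℝ) - i) * L ≤ u j

theorem Feasible.mono {l u : ℕ → ℝ} {n : ℕ} {L L' : ℝ} (h : Feasible l u n L) (hL : L' ≤ L) :
    Feasible l u n L' := fun i j hij hj => by
  have h1 : (i : ℝ) < j := by exact_mod_cast hij
  nlinarith [h i j hij hj]

/-- State of the computation of the largest feasible gap after the positions `< j`: `L` is the
largest gap found to be possible so far (and at most `W`), and the cells `a, …, b - 1` of `H` hold
the vertices of the part of the upper hull of the points `(i, l i)`, `i < j`, that can still be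
extreme for a slope `L' ≤ L`. While the hull is being prepared for the insertion of the point `j`,
`dom` allows that this point replaces the deleted vertices; from then on, `L` is known to
be feasible for the position `j`, too. -/
structure Hull (l u : ℕ → ℝ) (n : ℕ) (W : ℝ) (a b j : ℕ) (H : ℕ → ℕ) (L : ℝ) : Prop where
  a_lt_b : a < b
  j_le : j ≤ n
  lt_j : ∀ h, a ≤ h → h < b → H h < j
  mono : ∀ h, a ≤ h → h + 1 < b → H h < H (h + 1)
  concave : ∀ h, a ≤ h → h + 2 < b →
    (l (H (h + 2)) - l (H (h + 1))) * ((H (h + 1) : ℝ) - H h) ≤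
      (l (H (h + 1)) - l (H h)) * ((H (h + 2) : ℝ) - H (h + 1))
  dom : ∀ i < j, ∀ L' ≤ L, (∃ h, a ≤ h ∧ h < b ∧ l i - i * L' ≤ l (H h) - H h * L') ∨
    ((∀ i < j, l i + ((j : ℝ) - i) * L ≤ u j) ∧ l i - i * L' ≤ l j - j * L')
  feasible : Feasible l u j L
  optimal : L ≤ W ∧ ∀ M ≤ W, Feasible l u n M → M ≤ L

namespace Hull

variable {l u : ℕ → ℝ} {n a b j : ℕ} {W L : ℝ} {H : ℕ → ℕ}

theorem init (hn : 0 < n) (hH : H 0 = 0) : Hull l u n W 0 1 1 H W where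
  a_lt_b := one_pos
  j_le := hn
  lt_j h _ hb := by obtain rfl : h = 0 := by omega
                    omega
  mono h _ hb := by omega
  concave h _ hb := by omega
  dom i hi L' _ := Or.inl ⟨0, le_rfl, one_pos, by
    obtain rfl : i = 0 := by omega
    rw [hH]⟩
  feasible i j hij hj := by omega
  optimal := ⟨le_rfl, fun M hM _ => hM⟩

theorem lower_gap (h : Hull l u n W a b j H L) {L' : ℝ} (hL : L' ≤ L)
    (hopt : ∀ M, Feasible l u n M → M ≤ L') : Hull l u n W a b j H L' where
  a_lt_b := h.a_lt_b
  j_le := h.j_le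
  lt_j := h.lt_j
  mono := h.mono
  concave := h.concave
  dom i hi M hM := (h.dom i hi M (hM.trans hL)).imp_right fun h' => ⟨fun i hi => by
    have : (i : ℝ) < j := by exact_mod_cast hi
    nlinarith [h'.1 i hi], h'.2⟩
  feasible := h.feasible.mono hL
  optimal := ⟨hL.trans h.optimal.1, fun M _ hM => hopt M hM⟩

/-- The gap is limited by the first vertex of the hull and the point `j`. -/
theorem lower_gap_front (h : Hull l u n W a b j H L) (hj : j < n)
    (hlt : u j - l (H a) < L * ((j : ℝ) - H a)) :
    Hull l u n W a b j H ((u j - l (H a)) / ((j : ℝ) - H a)) := by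
  have h1 : H a < j := h.lt_j a le_rfl h.a_lt_b
  have h2 : (0 : ℝ) < (j : ℝ) - H a := by
    have : (H a : ℝ) < j := by exact_mod_cast h1
    linarith
  refine h.lower_gap ((div_le_iff₀ h2).2 hlt.le) fun M hM => (le_div_iff₀ h2).2 ?_
  linarith [hM _ _ h1 hj]

/-- A first vertex that is beaten by the second one for the slope `L` is beaten for all smaller
slopes. -/
theorem pop_front (h : Hull l u n W a b j H L) (hab : a + 1 < b)
    (hlt : L * ((H (a + 1) : ℝ) - H a) < l (H (a + 1)) - l (H a)) :
    Hull l u n W (a + 1) b j H L where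
  a_lt_b := hab
  j_le := h.j_le
  lt_j i hi := h.lt_j i (by omega)
  mono i hi := h.mono i (by omega)
  concave i hi := h.concave i (by omega)
  dom i hi L' hL := by
    refine (h.dom i hi L' hL).imp_left ?_
    rintro ⟨v, hv, hvb, hle⟩
    rcases hv.eq_or_lt with rfl | hv
    · refine ⟨a + 1, le_rfl, hab, hle.trans ?_⟩
      have : (H a : ℝ) < H (a + 1) := by exact_mod_cast h.mono a le_rfl hab
      nlinarith
    · exact ⟨v, hv, hvb, hle⟩
  feasible := h.feasible
  optimal := h.optimal

/-- On a concave chain whose first slope is at most `L`, the first vertex is extreme for the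
slope `L`. -/
theorem front_extreme (h : Hull l u n W a b j H L)
    (hge : a + 1 < b → l (H (a + 1)) - l (H a) ≤ L * ((H (a + 1) : ℝ) - H a))
    (v : ℕ) (hv : a ≤ v) (hvb : v < b) : l (H v) - H v * L ≤ l (H a) - H a * L := by
  have slope : ∀ v, a ≤ v → v + 1 < b → l (H (v + 1)) - l (H v) ≤ L * ((H (v + 1) : ℝ) - H v) := by
    intro v hv
    induction v, hv using Nat.le_induction with
    | base => exact hge
    | succ v hv ih =>
      intro hvb
      have h1 : (H v : ℝ) < H (v + 1) := by exact_mod_cast h.mono v hv (by omega)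
      have h2 : (H (v + 1) : ℝ) < H (v + 2) := by exact_mod_cast h.mono (v + 1) (by omega) hvb
      have h3 := h.concave v hv hvb
      have h4 := ih (by omega)
      refine le_of_mul_le_mul_right (h3.trans ?_) (sub_pos.2 h1)
      calc _ ≤ L * ((H (v + 1) : ℝ) - H v) * ((H (v + 2) : ℝ) - H (v + 1)) :=
            mul_le_mul_of_nonneg_right h4 (sub_pos.2 h2).le
        _ = _ := by ring
  induction v, hv using Nat.le_induction with
  | base => exact le_rfl
  | succ v hv ih => linarith [ih (by omega), slope v hv hvb]

/-- If the gap is possible for the first vertex and the point `j`, and the first vertex is extreme,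
then the gap is possible for all points before `j`. -/
theorem feasible_at (h : Hull l u n W a b j H L)
    (hge : a + 1 < b → l (H (a + 1)) - l (H a) ≤ L * ((H (a + 1) : ℝ) - H a))
    (hfr : L * ((j : ℝ) - H a) ≤ u j - l (H a)) : ∀ i < j, l i + ((j : ℝ) - i) * L ≤ u j := by
  intro i hi
  rcases h.dom i hi L le_rfl with ⟨v, hv, hvb, hle⟩ | h'
  · linarith [h.front_extreme hge v hv hvb]
  · exact h'.1 i hi

/-- A last vertex that lies below the segment from the last but one vertex to the point `j` is
not needed. -/
theorem pop_back (h : Hull l u n W a b j H L) (hab : a + 1 < b)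
    (hj : ∀ i < j, l i + ((j : ℝ) - i) * L ≤ u j)
    (hle : (l (H (b - 1)) - l (H (b - 2))) * ((j : ℝ) - H (b - 1)) ≤
      (l j - l (H (b - 1))) * ((H (b - 1) : ℝ) - H (b - 2))) :
    Hull l u n W a (b - 1) j H L where
  a_lt_b := by omega
  j_le := h.j_le
  lt_j i hi hb := h.lt_j i hi (by omega)
  mono i hi hb := h.mono i hi (by omega)
  concave i hi hb := h.concave i hi (by omega)
  dom i hi L' hL := by
    rcases h.dom i hi L' hL with ⟨v, hv, hvb, hv'⟩ | h'
    · rcases Nat.lt_or_ge v (b - 1) with hlt | hge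
      · exact Or.inl ⟨v, hv, hlt, hv'⟩
      obtain rfl : v = b - 1 := by omega
      obtain ⟨w, rfl⟩ : ∃ w, b = w + 2 := ⟨b - 2, by omega⟩
      simp only [Nat.add_sub_cancel, show w + 2 - 1 = w + 1 from rfl] at hle hv'
      have h1 : (H w : ℝ) < H (w + 1) := by exact_mod_cast h.mono w (by omega) (by omega)
      have h2 : (H (w + 1) : ℝ) < j := by exact_mod_cast h.lt_j (w + 1) (by omega) (by omega)
      -- for the slope `L'`, the middle point of the three is not better than both others
      by_cases h3 : l (H (w + 1)) - H (w + 1) * L' ≤ l (H w) - H w * L'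
      · exact Or.inl ⟨w, by omega, by omega, hv'.trans h3⟩
      · refine Or.inr ⟨hj, hv'.trans ?_⟩
        have h4 : L' * ((H (w + 1) : ℝ) - H w) ≤ l (H (w + 1)) - l (H w) := by linarith
        have h5 := (mul_le_mul_of_nonneg_right h4 (sub_pos.2 h2).le).trans hle
        have h6 : L' * ((j : ℝ) - H (w + 1)) ≤ l j - l (H (w + 1)) :=
          le_of_mul_le_mul_right (by linarith) (sub_pos.2 h1)
        linarith
    · exact Or.inr h'
  feasible := h.feasible
  optimal := h.optimal

theorem push (h : Hull l u n W a b j H L) (hjn : j < n)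
    (hj : ∀ i < j, l i + ((j : ℝ) - i) * L ≤ u j)
    (hlt : a + 1 < b → (l j - l (H (b - 1))) * ((H (b - 1) : ℝ) - H (b - 2)) ≤
      (l (H (b - 1)) - l (H (b - 2))) * ((j : ℝ) - H (b - 1))) :
    Hull l u n W a (b + 1) (j + 1) (Function.update H b j) L := by
  have hab := h.a_lt_b
  have old : ∀ v, v < b → Function.update H b j v = H v := fun v hv =>
    Function.update_of_ne hv.ne _ _
  have new : Function.update H b j b = j := Function.update_self _ _ _
  refine ⟨by omega, hjn, ?_, ?_, ?_, ?_, ?_, h.optimal⟩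
  · intro v hv hvb
    rcases Nat.lt_succ_iff_lt_or_eq.1 hvb with hvb | rfl
    · rw [old v hvb]
      exact (h.lt_j v hv hvb).trans (Nat.lt_succ_self j)
    · rw [new]; exact Nat.lt_succ_self j
  · intro v hv hvb
    rcases Nat.lt_succ_iff_lt_or_eq.1 hvb with hvb | rfl
    · rw [old v (by omega), old _ hvb]
      exact h.mono v hv hvb
    · rw [new, old v (by omega)]
      exact h.lt_j v hv (by omega)
  · intro v hv hvb
    rcases Nat.lt_succ_iff_lt_or_eq.1 hvb with hvb | rfl
    · rw [old v (by omega), old _ hvb, old _ (by omega)]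
      exact h.concave v hv hvb
    · rw [new, old v (by omega), old _ (by omega)]
      exact hlt (by omega)
  · intro i hi L' hL
    have key : ∀ v, a ≤ v → v < b → l i - i * L' ≤ l (H v) - H v * L' →
        ∃ h, a ≤ h ∧ h < b + 1 ∧ l i - i * L' ≤
          l (Function.update H b j h) - (Function.update H b j h : ℕ) * L' :=
      fun v hv hvb hle => ⟨v, hv, by omega, by rwa [old v hvb]⟩
    refine Or.inl ?_
    rcases Nat.lt_succ_iff_lt_or_eq.1 hi with hi | rfl
    · rcases h.dom i hi L' hL with ⟨v, hv, hvb, hle⟩ | h'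
      · exact key v hv hvb hle
      · exact ⟨b, hab.le, by omega, by rw [new]; exact h'.2⟩
    · exact ⟨b, hab.le, by omega, by rw [new]⟩
  · intro i k hik hk
    rcases Nat.lt_succ_iff_lt_or_eq.1 hk with hk | rfl
    · exact h.feasible i k hik hk
    · exact hj i hik

end Hull

/-- The leftmost points with gaps at least `L` that respect the lower bounds `l`; the
`t`-th point is `greedy l L (t + 1)`. -/
noncomputable def greedy (l : ℕ → ℝ) (L : ℝ) : ℕ → ℝ
  | 0 => l 0 - L
  | t + 1 => max (l t) (greedy l L t + L)

theorem greedy_eq (l : ℕ → ℝ) (L : ℝ) (t : ℕ) :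
    ∃ i ≤ t, greedy l L (t + 1) = l i + ((t : ℝ) - i) * L := by
  induction t with
  | zero => exact ⟨0, le_rfl, by simp [greedy]⟩
  | succ t ih =>
    obtain ⟨i, hi, hg⟩ := ih
    rcases max_choice (l (t + 1)) (greedy l L (t + 1) + L) with h | h
    · exact ⟨t + 1, le_rfl, by rw [greedy, h]; simp⟩
    · exact ⟨i, by omega, by rw [greedy, h, hg]; push_cast; ring⟩

theorem le_greedy (l : ℕ → ℝ) (L : ℝ) (t : ℕ) : l t ≤ greedy l L (t + 1) := le_max_left _ _

theorem greedy_add_le (l : ℕ → ℝ) (L : ℝ) (t : ℕ) : greedy l L t + L ≤ greedy l L (t + 1) :=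
  le_max_right _ _

theorem Feasible.greedy_add_le {l u : ℕ → ℝ} {n : ℕ} {L : ℝ} (h : Feasible l u n L) {t : ℕ}
    (ht : t + 1 < n) : greedy l L (t + 1) + L ≤ u (t + 1) := by
  obtain ⟨i, hi, hg⟩ := greedy_eq l L t
  have := h i (t + 1) (by omega) ht
  push_cast at this
  linarith

/-! ### The program -/

-- Arrays of natural numbers. Array `0` holds `n` and `k`, and `colorArr` holds the colors.
notation "colorArr" => 1
-- the first interval of the run of an interval
notation "firstArr" => 2
-- the last interval of the run with a given first interval
notation "lastArr" => 3
-- one plus the last interval of a given color so far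
notation "seenArr" => 4
-- one plus the successor of a run
notation "succArr" => 5
-- one plus the predecessor of a run
notation "predArr" => 6
-- the order in which the runs are placed
notation "orderArr" => 7
-- the vertices of the upper hull
notation "hullArr" => 8

-- Variables of natural number type, grouped by loop.
notation "runIdx" => 10
notation "winEnd" => 11
notation "winStart" => 12
notation "numColors" => 13
notation "scanIdx" => 14
notation "walker" => 15
notation "numPlaced" => 16
notation "hullStart" => 17
notation "hullEnd" => 18
notation "hullIdx" => 19
notation "spreadIdx" => 20
notation "outIdx" => 21

-- Arrays of real numbers; the left endpoints are in `leftArr`, and the output goes to `outArr`.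
notation "leftArr" => 0
notation "outArr" => 1
-- bounds for the position of the `t`-th run in the order, and its shift
notation "lowerArr" => 2
notation "upperArr" => 3
notation "shiftArr" => 4
-- the position of the run with a given first interval
notation "posArr" => 5

-- Real variables.
notation "shiftVar" => 6
notation "gapVar" => 7
notation "positionVar" => 8
notation "widthVar" => 9

/-- The number of intervals. -/
def sizeExpr : NatExpr := nvar 0

/-- Find the runs: maximal blocks of consecutive intervals of the same color. -/
def runsBody : Program :=
  .seq
    (.ite (.both (.natLt (.const 0) (nvar runIdx))
        (.natEq (.get colorArr (.sub (nvar runIdx) (.const 1))) (natAt colorArr runIdx)))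
      (.setNat firstArr (nvar runIdx) (.get firstArr (.sub (nvar runIdx) (.const 1))))
      (.setNat firstArr (nvar runIdx) (nvar runIdx))) <|
  .seq (.setNat lastArr (natAt firstArr runIdx) (nvar runIdx))
    (incr runIdx)

/-- Link the first runs of the minimal color-spanning windows to the last ones: the window is
shortened from the left as long as its first color occurs again, and otherwise extended. -/
def linksBody : Program :=
  .ite (.both (.natLt (nvar winStart) (nvar winEnd))
      (.or
        (.neg (.natEq (.get seenArr (natAt colorArr winStart)) (.add (nvar winStart) (.const 1))))
        (.natEq (natAt colorArr winStart) (natAt colorArr winEnd))))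
    (incr winStart) <|
  .seq (.ite (.natEq (.get seenArr (natAt colorArr winEnd)) (.const 0)) (incr numColors) .skip) <|
  .seq (.setNat seenArr (natAt colorArr winEnd) (.add (nvar winEnd) (.const 1))) <|
  .seq
    (.ite (.both (.both (.natLt (nvar winStart) (nvar winEnd))
          (.natEq (nvar numColors) (.get 0 (.const 1))))
        (.both (.natEq (.get succArr (natAt firstArr winStart)) (.const 0))
          (.natEq (natAt firstArr winEnd) (nvar winEnd))))
      (.seq (.setNat succArr (natAt firstArr winStart) (.add (nvar winEnd) (.const 1)))
        (.setNat predArr (nvar winEnd) (.add (natAt firstArr winStart) (.const 1))))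
      .skip)
    (incr winEnd)

/-- List the paths formed by the links one after the other, and shift each of them far to the right
of its predecessor. -/
def orderBody : Program :=
  .ite (.natLt (.const 0) (nvar walker))
    (.seq (.setNat orderArr (nvar numPlaced) (.sub (nvar walker) (.const 1))) <|
     .seq (.setReal shiftArr (nvar numPlaced) (rvar shiftVar)) <|
     .seq (.setReal lowerArr (nvar numPlaced)
        (.add (.get leftArr (.get lastArr (.sub (nvar walker) (.const 1)))) (rvar shiftVar))) <|
     .seq (.setReal upperArr (nvar numPlaced)
        (.add (.add (.get leftArr (.sub (nvar walker) (.const 1))) (.const 1)) (rvar shiftVar))) <|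
     .seq (.setNat walker (.const 0) (.get succArr (.sub (nvar walker) (.const 1))))
        (incr numPlaced))
    (.seq
      (.ite (.natEq (natAt predArr scanIdx) (.const 0))
        (.seq (.setNat walker (.const 0) (.add (nvar scanIdx) (.const 1)))
          (.setReal shiftVar (.const 0)
            (.add (rvar shiftVar) (.add (rvar widthVar) (rvar widthVar)))))
        .skip)
      (incr scanIdx))

/-- Lower the gap such that it is possible for the first vertex of the hull and the current
point. -/
def hullGap : Program :=
  .ite (.realLt (.sub (realAt upperArr hullIdx) (.get lowerArr (natAt hullArr hullStart)))
      (.mul (rvar gapVar) (.sub (.ofNat (nvar hullIdx)) (.ofNat (natAt hullArr hullStart)))))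
    (.setReal gapVar (.const 0)
      (.div (.sub (realAt upperArr hullIdx) (.get lowerArr (natAt hullArr hullStart)))
        (.sub (.ofNat (nvar hullIdx)) (.ofNat (natAt hullArr hullStart)))))
    .skip

/-- Delete a vertex of the upper hull at its beginning or at its end, or append a vertex. -/
def hullStep : Program :=
  .ite (.both (.natLt (.add (nvar hullStart) (.const 1)) (nvar hullEnd))
      (.realLt
        (.mul (rvar gapVar) (.sub (.ofNat (.get hullArr (.add (nvar hullStart) (.const 1))))
          (.ofNat (natAt hullArr hullStart))))
        (.sub (.get lowerArr (.get hullArr (.add (nvar hullStart) (.const 1))))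
          (.get lowerArr (natAt hullArr hullStart)))))
    (incr hullStart) <|
  .ite (.both (.natLt (.add (nvar hullStart) (.const 1)) (nvar hullEnd))
      (.neg (.realLt
        (.mul (.sub (realAt lowerArr hullIdx)
            (.get lowerArr (.get hullArr (.sub (nvar hullEnd) (.const 1)))))
          (.sub (.ofNat (.get hullArr (.sub (nvar hullEnd) (.const 1))))
            (.ofNat (.get hullArr (.sub (nvar hullEnd) (.const 2))))))
        (.mul (.sub (.get lowerArr (.get hullArr (.sub (nvar hullEnd) (.const 1))))
            (.get lowerArr (.get hullArr (.sub (nvar hullEnd) (.const 2)))))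
          (.sub (.ofNat (nvar hullIdx))
            (.ofNat (.get hullArr (.sub (nvar hullEnd) (.const 1)))))))))
    (.setNat hullEnd (.const 0) (.sub (nvar hullEnd) (.const 1))) <|
  .seq (.setNat hullArr (nvar hullEnd) (nvar hullIdx)) <|
  .seq (incr hullEnd) (incr hullIdx)

/-- One step in the computation of the largest feasible gap. -/
def hullBody : Program := .seq hullGap hullStep
/-- Place the runs greedily and undo the shifts. -/
def spreadBody : Program :=
  .seq (.setReal positionVar (.const 0) (.add (rvar positionVar) (rvar gapVar))) <|
  .seq (.ite (.realLt (rvar positionVar) (realAt lowerArr spreadIdx))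
      (.setReal positionVar (.const 0) (realAt lowerArr spreadIdx)) .skip) <|
  .seq (.setReal posArr (natAt orderArr spreadIdx)
      (.sub (rvar positionVar) (realAt shiftArr spreadIdx)))
    (incr spreadIdx)

/-- Represent each interval by the position of its run, or by its right endpoint if
this is smaller. -/
def outputBody : Program :=
  .seq
    (.ite (.realLt (.get posArr (natAt firstArr outIdx))
        (.add (realAt leftArr outIdx) (.const 1)))
      (.setReal outArr (nvar outIdx) (.get posArr (natAt firstArr outIdx)))
      (.setReal outArr (nvar outIdx) (.add (realAt leftArr outIdx) (.const 1))))
    (incr outIdx)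

/-- The loop that runs the variable `i` up to `n`. -/
def upTo (i : ℕ) (p : Program) : Program := .while (.natLt (nvar i) sizeExpr) p

/-- The loop of `orderBody`. -/
def orderLoop : Program :=
  .while (.or (.natLt (.const 0) (nvar walker)) (.natLt (nvar scanIdx) sizeExpr)) orderBody

/-- The width of the smallest interval that contains all given intervals; it bounds every minimum
color-spanning interval. -/
def setWidth : Program :=
  .setReal widthVar (.const 0)
    (.sub (.add (.get leftArr (.sub sizeExpr (.const 1))) (.const 1)) (.get leftArr (.const 0)))

/-- Initially, the hull consists of the point `0`. -/
def initHull : Program :=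
  .seq (.setReal gapVar (.const 0) (rvar widthVar)) (.seq (incr hullEnd) (incr hullIdx))

/-- The first point is placed at its lower bound. -/
def initSpread : Program :=
  .setReal positionVar (.const 0) (.sub (.get lowerArr (.const 0)) (rvar gapVar))

/-- The whole program. -/
def program : Program :=
  .seq (upTo runIdx runsBody) <| .seq (upTo winEnd linksBody) <| .seq setWidth <|
  .seq orderLoop <| .seq initHull <| .seq (upTo hullIdx hullBody) <| .seq initSpread <|
  .seq (upTo spreadIdx spreadBody) (upTo outIdx outputBody)

attribute [simp] Program.wp Test.Holds Test.holds_or NatExpr.eval RealExpr.eval nvar rvar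
  natAt realAt incr sizeExpr Memory.setNat Memory.setReal

/-! ### The hull loop -/

/-- The memory represents a state of the computation of the largest feasible gap. -/
def HullMem (l u : ℕ → ℝ) (n : ℕ) (W : ℝ) (m : Memory) : Prop :=
  m.nat 0 0 = n ∧ m.real lowerArr = l ∧ m.real upperArr = u ∧
    Hull l u n W (m.nat hullStart 0) (m.nat hullEnd 0) (m.nat hullIdx 0) (m.nat hullArr)
      (m.real gapVar 0)

theorem wp_hullStep {l u : ℕ → ℝ} {n : ℕ} {W : ℝ} {m : Memory} (hm : HullMem l u n W m)
    (hlt : m.nat hullIdx 0 < n)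
    (hfr : m.real gapVar 0 * ((m.nat hullIdx 0 : ℝ) - m.nat hullArr (m.nat hullStart 0)) ≤
      u (m.nat hullIdx 0) - l (m.nat hullArr (m.nat hullStart 0))) :
    hullStep.wp (fun m' => HullMem l u n W m' ∧
      2 * (n - m'.nat hullIdx 0) + (m'.nat hullEnd 0 - m'.nat hullStart 0) <
        2 * (n - m.nat hullIdx 0) + (m.nat hullEnd 0 - m.nat hullStart 0)) m := by
  obtain ⟨hn, hl, hu, h⟩ := hm
  have hab := h.a_lt_b
  refine ⟨?_, fun hge => ⟨?_, ?_⟩⟩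
  · rintro ⟨hab', hslope⟩
    simp [hl] at hab' hslope
    simp [HullMem, hn, hl, hu]
    exact ⟨h.pop_front hab' hslope, by omega⟩
  · rintro ⟨hab', hslope⟩
    have hj := h.feasible_at (fun _ => by simp [hl] at hge hab' ⊢; exact hge hab') hfr
    simp [hl] at hab' hslope
    simp [HullMem, hn, hl, hu]
    exact ⟨h.pop_back hab' hj hslope, by omega⟩
  · intro hslope
    have hj := h.feasible_at (fun hab' => by simp [hl] at hge ⊢; exact hge hab') hfr
    simp [hl] at hslope
    simp [HullMem, hn, hl, hu]
    exact ⟨h.push hlt hj fun hab' => (hslope hab').le, by omega⟩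

theorem wp_hullBody {l u : ℕ → ℝ} {n : ℕ} {W : ℝ} {m : Memory} (hm : HullMem l u n W m)
    (hlt : m.nat hullIdx 0 < n) :
    hullBody.wp (fun m' => HullMem l u n W m' ∧
      2 * (n - m'.nat hullIdx 0) + (m'.nat hullEnd 0 - m'.nat hullStart 0) <
        2 * (n - m.nat hullIdx 0) + (m.nat hullEnd 0 - m.nat hullStart 0)) m := by
  obtain ⟨hn, hl, hu, h⟩ := id hm
  refine ⟨fun hc => ?_, fun hc => ?_⟩
  · simp [hl, hu] at hc
    have hpos : (m.nat hullArr (m.nat hullStart 0) : ℝ) < m.nat hullIdx 0 := by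
      exact_mod_cast h.lt_j _ le_rfl h.a_lt_b
    refine wp_hullStep ?_ hlt ?_
    · simp [HullMem, hn, hl, hu]
      exact h.lower_gap_front hlt hc
    · simp [hl, hu]
      rw [div_mul_cancel₀ _ (sub_pos.2 hpos).ne']
  · simp [hl, hu] at hc
    exact wp_hullStep hm hlt hc

theorem exists_runs_hull {l u : ℕ → ℝ} {n : ℕ} {W : ℝ} {m : Memory} (hm : HullMem l u n W m)
    (hb : m.nat hullEnd 0 = 1) :
    ∃ t m', Runs (upTo hullIdx hullBody) m t m' ∧
      t ≤ (2 * n + 2) * ((Test.natLt (nvar hullIdx) sizeExpr).cost + 1 + hullBody.bound) ∧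
      Feasible l u n (m'.real gapVar 0) ∧
      ∀ M ≤ W, Feasible l u n M → M ≤ m'.real gapVar 0 := by
  obtain ⟨t, m', hr, ht, hI, hex⟩ := exists_runs_while (b := .natLt (nvar hullIdx) sizeExpr)
    (p := hullBody) (HullMem l u n W)
    (fun m' => 2 * (n - m'.nat hullIdx 0) + (m'.nat hullEnd 0 - m'.nat hullStart 0))
    (fun m' h hlt => wp_hullBody h (by simpa [h.1] using hlt)) hm
  refine ⟨t, m', hr, ht.trans (Nat.mul_le_mul_right _ (by omega)), ?_⟩
  obtain ⟨hn, -, -, h⟩ := hI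
  simp [hn] at hex
  rw [le_antisymm h.j_le hex] at h
  exact ⟨h.feasible, h.optimal.2⟩

/-! ### Runs -/

/-- The first index of the run of `i`, the maximal block of consecutive indices of the same color
that contains `i`. -/
def runFirst (c : ℕ → ℕ) : ℕ → ℕ
  | 0 => 0
  | i + 1 => if c i = c (i + 1) then runFirst c i else i + 1

theorem runFirst_le (c : ℕ → ℕ) (i : ℕ) : runFirst c i ≤ i := by
  induction i with
  | zero => exact le_rfl
  | succ i ih => rw [runFirst]; split_ifs <;> omega

theorem color_runFirst (c : ℕ → ℕ) (i : ℕ) : c (runFirst c i) = c i := by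
  induction i with
  | zero => rfl
  | succ i ih => rw [runFirst]; split_ifs with h <;> simp [ih, h]

theorem color_eq_of_runFirst_eq {c : ℕ → ℕ} {i j : ℕ} (h : runFirst c i = runFirst c j) :
    c i = c j := by
  rw [← color_runFirst c i, h, color_runFirst c]

/-- Indices from the first index of a run up to one of its members belong to the run. -/
theorem runFirst_eq_of_between {c : ℕ → ℕ} {i t : ℕ} (h : runFirst c i ≤ t) (ht : t ≤ i) :
    runFirst c t = runFirst c i := by
  induction i with
  | zero => rw [Nat.le_zero.1 ht]
  | succ i ih =>
    rcases ht.eq_or_lt with rfl | ht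
    · rfl
    · rw [runFirst] at h ⊢
      split_ifs at h ⊢
      · exact ih h (by omega)
      · omega

theorem runFirst_eq_between {c : ℕ → ℕ} {i j t : ℕ} (h : runFirst c i = runFirst c j)
    (hit : i ≤ t) (htj : t ≤ j) : runFirst c t = runFirst c j :=
  runFirst_eq_of_between ((h ▸ runFirst_le c i).trans hit) htj

/-- Between two indices of different runs the color changes. -/
theorem exists_color_ne_of_runFirst_ne {c : ℕ → ℕ} {i j : ℕ} (hij : i ≤ j)
    (h : runFirst c i ≠ runFirst c j) : ∃ t, i ≤ t ∧ t ≤ j ∧ c t ≠ c j := by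
  induction j, hij using Nat.le_induction with
  | base => exact absurd rfl h
  | succ j hij ih =>
    by_cases hc : c j = c (j + 1)
    · rw [runFirst, if_pos hc] at h
      obtain ⟨t, h1, h2, h3⟩ := ih h
      exact ⟨t, h1, by omega, hc ▸ h3⟩
    · exact ⟨j, hij, by omega, hc⟩

theorem runFirst_eq_self {c : ℕ → ℕ} {i : ℕ} (h : ∀ j, j + 1 = i → c j ≠ c i) :
    runFirst c i = i := by
  cases i with
  | zero => rfl
  | succ i => rw [runFirst, if_neg (h i rfl)]

/-- After `i` rounds, `f` holds the first indices of the runs and `g` the last ones. -/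
def RunsState (c : ℕ → ℕ) (i : ℕ) (f g : ℕ → ℕ) : Prop :=
  ∀ t < i, f t = runFirst c t ∧ t ≤ g (runFirst c t) ∧ g (runFirst c t) < i ∧
    runFirst c (g (runFirst c t)) = runFirst c t

theorem RunsState.step {c : ℕ → ℕ} {i : ℕ} {f g : ℕ → ℕ} (h : RunsState c i f g) :
    RunsState c (i + 1) (Function.update f i (runFirst c i))
      (Function.update g (runFirst c i) i) := by
  intro t ht
  simp only [Function.update_apply]
  rcases Nat.lt_succ_iff_lt_or_eq.1 ht with ht | rfl
  · obtain ⟨h1, h2, h3, h4⟩ := h t ht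
    rw [if_neg ht.ne]
    split_ifs with hr
    · exact ⟨h1, ht.le, by omega, hr.symm⟩
    · exact ⟨h1, h2, by omega, h4⟩
  · simp

/-- The memory represents a state of the computation of the runs. -/
def RunsMem (c : ℕ → ℕ) (n : ℕ) (m : Memory) : Prop :=
  m.nat 0 0 = n ∧ m.nat colorArr = c ∧ m.nat runIdx 0 ≤ n ∧
    RunsState c (m.nat runIdx 0) (m.nat firstArr) (m.nat lastArr) ∧ ∀ v, m.nat lastArr v < n

theorem wp_runsBody {c : ℕ → ℕ} {n : ℕ} {m : Memory} (hm : RunsMem c n m)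
    (hlt : m.nat runIdx 0 < n) :
    runsBody.wp (fun m' => RunsMem c n m' ∧ n - m'.nat runIdx 0 < n - m.nat runIdx 0) m := by
  obtain ⟨hn, hc, hle, h, hg⟩ := hm
  obtain ⟨i, hi⟩ : ∃ i, m.nat runIdx 0 = i := ⟨_, rfl⟩
  rw [hi] at hlt hle h
  have hg' : ∀ a v, Function.update (m.nat lastArr) a i v < n := fun a v => by
    rw [Function.update_apply]
    split_ifs
    exacts [hlt, hg v]
  refine ⟨?_, ?_⟩
  · intro hcol
    simp [hi, hc] at hcol
    obtain ⟨j, rfl⟩ : ∃ j, i = j + 1 := ⟨i - 1, by omega⟩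
    simp at hcol
    have hr : m.nat firstArr j = runFirst c (j + 1) := by
      rw [runFirst, if_pos hcol, (h j (by omega)).1]
    simp [RunsMem, hi, hn, hc, hr]
    exact ⟨⟨hlt, h.step, hg' _⟩, by omega⟩
  · intro hcol
    simp [hi, hc] at hcol
    have hr : runFirst c i = i := runFirst_eq_self (by
      rintro j rfl
      exact hcol (by omega))
    have := h.step
    rw [hr] at this
    simp [RunsMem, hi, hn, hc]
    exact ⟨⟨hlt, this, hg' _⟩, by omega⟩

theorem exists_runs_runs {c : ℕ → ℕ} {n : ℕ} {m : Memory} (hm : RunsMem c n m) :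
    ∃ t m', Runs (upTo runIdx runsBody) m t m' ∧
      t ≤ (2 * n + 2) * ((Test.natLt (nvar runIdx) sizeExpr).cost + 1 + runsBody.bound) ∧
      RunsState c n (m'.nat firstArr) (m'.nat lastArr) ∧ ∀ v, m'.nat lastArr v < n := by
  obtain ⟨t, m', hr, ht, hI, hex⟩ := exists_runs_while (b := .natLt (nvar runIdx) sizeExpr)
    (p := runsBody) (RunsMem c n) (fun m' => n - m'.nat runIdx 0)
    (fun m' h hlt => wp_runsBody h (by simpa [h.1] using hlt)) hm
  refine ⟨t, m', hr, ht.trans (Nat.mul_le_mul_right _ (by omega)), ?_⟩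
  obtain ⟨hn, -, hle, h⟩ := hI
  simp [hn] at hex
  rwa [le_antisymm hle hex] at h

/-! ### Windows and links -/

/-- Every color occurs among the indices `s, …, e`. -/
def Covers (c : ℕ → ℕ) (k s e : ℕ) : Prop := ∀ a < k, ∃ i, s ≤ i ∧ i ≤ e ∧ c i = a

theorem Covers.mono {c : ℕ → ℕ} {k s e s' e' : ℕ} (h : Covers c k s e) (hs : s' ≤ s)
    (he : e ≤ e') : Covers c k s' e' := fun a ha => by
  obtain ⟨i, h1, h2, h3⟩ := h a ha
  exact ⟨i, by omega, by omega, h3⟩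

/-- `s, …, e` is a color-spanning window of indices that cannot be shortened from the left. -/
structure Window (c : ℕ → ℕ) (k s e : ℕ) : Prop where
  lt : s < e
  covers : Covers c k s e
  left : ∀ i, s < i → i ≤ e → c i ≠ c s

/-- `seen a` is one plus the last of the indices `< e` of color `a`, or zero, and `d` is the number
of colors of these indices. -/
structure Seen (c : ℕ → ℕ) (e d : ℕ) (seen : ℕ → ℕ) : Prop where
  last : ∀ a t, seen a = t + 1 → t < e ∧ c t = a ∧ ∀ i, t < i → i < e → c i ≠ a
  ne_zero : ∀ i < e, seen (c i) ≠ 0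
  card : d = ((Finset.range e).image c).card

theorem Seen.step {c : ℕ → ℕ} {e d : ℕ} {seen : ℕ → ℕ} (h : Seen c e d seen) :
    Seen c (e + 1) (if seen (c e) = 0 then d + 1 else d)
      (Function.update seen (c e) (e + 1)) where
  last a t ht := by
    rw [Function.update_apply] at ht
    split_ifs at ht with ha
    · obtain rfl : e = t := by omega
      exact ⟨by omega, ha.symm, fun i h1 h2 => by omega⟩
    · obtain ⟨h1, h2, h3⟩ := h.last a t ht
      refine ⟨by omega, h2, fun i hi hie => ?_⟩
      rcases Nat.lt_succ_iff_lt_or_eq.1 hie with hie | rfl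
      · exact h3 i hi hie
      · exact Ne.symm ha
  ne_zero i hi := by
    rw [Function.update_apply]
    split_ifs with ha
    · omega
    · refine h.ne_zero i ((Nat.lt_succ_iff_lt_or_eq.1 hi).resolve_right ?_)
      rintro rfl
      exact ha rfl
  card := by
    rw [Finset.range_add_one, Finset.image_insert, h.card]
    split_ifs with h0
    · rw [Finset.card_insert_of_notMem]
      intro hmem
      obtain ⟨i, hi, hie⟩ := Finset.mem_image.1 hmem
      exact h.ne_zero i (Finset.mem_range.1 hi) (hie ▸ h0)
    · rw [Finset.insert_eq_of_mem]
      obtain ⟨t, ht⟩ := Nat.exists_eq_succ_of_ne_zero h0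
      obtain ⟨h1, h2, -⟩ := h.last _ t ht
      exact Finset.mem_image.2 ⟨t, Finset.mem_range.2 h1, h2⟩

theorem Seen.covers_iff {c : ℕ → ℕ} {e d k : ℕ} {seen : ℕ → ℕ} (h : Seen c (e + 1) d seen)
    (hk : ∀ i ≤ e, c i < k) : d = k ↔ Covers c k 0 e := by
  have hsub : (Finset.range (e + 1)).image c ⊆ Finset.range k := fun a ha => by
    obtain ⟨i, hi, rfl⟩ := Finset.mem_image.1 ha
    exact Finset.mem_range.2 (hk i (Nat.lt_succ_iff.1 (Finset.mem_range.1 hi)))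
  constructor
  · intro hd a ha
    have heq := Finset.eq_of_subset_of_card_le hsub (by rw [Finset.card_range, ← h.card, hd])
    obtain ⟨i, hi, hia⟩ := Finset.mem_image.1 (heq.symm ▸ Finset.mem_range.2 ha)
    exact ⟨i, Nat.zero_le i, Nat.lt_succ_iff.1 (Finset.mem_range.1 hi), hia⟩
  · intro hc
    rw [h.card, Finset.Subset.antisymm hsub, Finset.card_range]
    intro a ha
    obtain ⟨i, -, hi, hia⟩ := hc a (Finset.mem_range.1 ha)
    exact Finset.mem_image.2 ⟨i, Finset.mem_range.2 (Nat.lt_succ_iff.2 hi), hia⟩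

/-- State of the search for links when the indices `< e` have been processed, and the indices `< s`
have been removed from the window. Runs are represented by their first indices; `nx v = w + 1`, or
equivalently `pr w = v + 1`, says that the run `v` is linked to the run `w`. Every link
comes from a color-spanning window, and every minimal window gives rise to a link. -/
structure Links (c : ℕ → ℕ) (k e s : ℕ) (nx pr : ℕ → ℕ) : Prop where
  s_le : s ≤ e
  cover : ∀ i < e, ∃ j, s ≤ j ∧ j ≤ e ∧ c j = c i
  nx_iff_pr : ∀ v w, nx v = w + 1 ↔ pr w = v + 1
  sound : ∀ v w, nx v = w + 1 →
    w < e ∧ runFirst c w = w ∧ ∃ t, runFirst c t = v ∧ Window c k t w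
  complete : ∀ t w, w < e → Window c k t w → (∀ i, t ≤ i → i < w → c i ≠ c w) →
    nx (runFirst c t) = w + 1

namespace Links

variable {c : ℕ → ℕ} {k e s : ℕ} {nx pr : ℕ → ℕ}

theorem pop (h : Links c k e s nx pr) (hs : s < e) (hex : ∃ i, s < i ∧ i ≤ e ∧ c i = c s) :
    Links c k e (s + 1) nx pr where
  s_le := hs
  cover i hi := by
    obtain ⟨j, h1, h2, h3⟩ := h.cover i hi
    rcases h1.eq_or_lt with rfl | h1
    · obtain ⟨t, h4, h5, h6⟩ := hex
      exact ⟨t, h4, h5, h6.trans h3⟩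
    · exact ⟨j, h1, h2, h3⟩
  nx_iff_pr := h.nx_iff_pr
  sound := h.sound
  complete := h.complete

theorem covers (h : Links c k e s nx pr) (hc : Covers c k 0 e) : Covers c k s e := by
  intro a ha
  obtain ⟨i, -, hi, rfl⟩ := hc a ha
  rcases hi.eq_or_lt with rfl | hi
  · exact ⟨i, h.s_le, le_rfl, rfl⟩
  · exact h.cover i hi

/-- There is at most one window with a given right end that cannot be shortened from the left. -/
theorem start_eq (h : Links c k e s nx pr) (hk : ∀ i ≤ e, c i < k)
    (hleft : ∀ i, s < i → i ≤ e → c i ≠ c s) {t : ℕ} (hw : Window c k t e) : t = s := by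
  rcases lt_trichotomy t s with hlt | rfl | hlt
  · obtain ⟨i, h1, h2, h3⟩ := h.covers (hw.covers.mono (Nat.zero_le t) le_rfl) (c t)
      (hk t hw.lt.le)
    exact absurd h3 (hw.left i (by omega) h2)
  · rfl
  · obtain ⟨i, h1, h2, h3⟩ := hw.covers (c s) (hk s h.s_le)
    exact absurd h3 (hleft i (by omega) h2)

theorem extend_link (h : Links c k e s nx pr) (hk : ∀ i ≤ e, c i < k)
    (hleft : ∀ i, s < i → i ≤ e → c i ≠ c s) (hs : s < e) (hc : Covers c k 0 e)
    (hnx : nx (runFirst c s) = 0) (he : runFirst c e = e) :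
    Links c k (e + 1) s (Function.update nx (runFirst c s) (e + 1))
      (Function.update pr e (runFirst c s + 1)) where
  s_le := by omega
  cover i hi := by
    obtain ⟨j, h1, h2, h3⟩ := h.covers hc (c i) (hk i (by omega))
    exact ⟨j, h1, by omega, h3⟩
  nx_iff_pr v w := by
    have hpr : ∀ v, pr e ≠ v + 1 := fun v hv => by
      have := (h.sound v e ((h.nx_iff_pr v e).2 hv)).1
      omega
    simp only [Function.update_apply]
    split_ifs with h1 h2 h2
    · simp [h1, h2]
    · refine ⟨fun h' => absurd ?_ h2, fun h' => ?_⟩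
      · omega
      · rw [← h.nx_iff_pr, h1, hnx] at h'
        omega
    · refine ⟨fun h' => ?_, fun h' => absurd ?_ h1⟩
      · rw [h.nx_iff_pr, h2] at h'
        exact absurd h' (hpr v)
      · omega
    · exact h.nx_iff_pr v w
  sound v w hvw := by
    rw [Function.update_apply] at hvw
    split_ifs at hvw with hv
    · obtain rfl : e = w := by omega
      exact ⟨by omega, he, s, hv.symm, hs, h.covers hc, hleft⟩
    · obtain ⟨h1, h2⟩ := h.sound v w hvw
      exact ⟨by omega, h2⟩
  complete t w hwe hw hright := by
    rcases Nat.lt_succ_iff_lt_or_eq.1 hwe with hwe | rfl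
    · have := h.complete t w hwe hw hright
      rwa [Function.update_of_ne]
      intro heq
      rw [heq, hnx] at this
      omega
    · rw [h.start_eq hk hleft hw, Function.update_self]

/-- If the run of `s` is already linked, then the window that ends at `e` is not minimal. -/
theorem extend_no_link (h : Links c k e s nx pr) (hk : ∀ i ≤ e, c i < k)
    (hleft : ∀ i, s < i → i ≤ e → c i ≠ c s)
    (hno : ¬ (s < e ∧ Covers c k 0 e ∧ nx (runFirst c s) = 0 ∧ runFirst c e = e)) :
    Links c k (e + 1) s nx pr where
  s_le := h.s_le.trans (Nat.le_succ e)
  cover i hi := by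
    rcases Nat.lt_succ_iff_lt_or_eq.1 hi with hi | rfl
    · obtain ⟨j, h1, h2, h3⟩ := h.cover i hi
      exact ⟨j, h1, by omega, h3⟩
    · exact ⟨i, h.s_le, by omega, rfl⟩
  nx_iff_pr := h.nx_iff_pr
  sound v w hvw := by
    obtain ⟨h1, h2⟩ := h.sound v w hvw
    exact ⟨by omega, h2⟩
  complete t w hwe hw hright := by
    rcases Nat.lt_succ_iff_lt_or_eq.1 hwe with hwe | rfl
    · exact h.complete t w hwe hw hright
    · obtain rfl := h.start_eq hk hleft hw
      refine absurd ⟨hw.lt, hw.covers.mono (Nat.zero_le _) le_rfl, ?_, ?_⟩ hno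
      · by_contra hne
        obtain ⟨z, hz⟩ := Nat.exists_eq_succ_of_ne_zero hne
        obtain ⟨hzw, -, y, hy, hyz⟩ := h.sound _ z hz
        have hty : t ≤ y := by
          by_contra hlt
          have hrun := runFirst_eq_between hy (le_refl y) (by omega : y ≤ t)
          rcases le_total t z with htz | hzt
          · exact hyz.left t (by omega) htz (color_eq_of_runFirst_eq hrun.symm)
          · refine hyz.left z hyz.lt le_rfl (color_eq_of_runFirst_eq ?_)
            rw [runFirst_eq_between hy hyz.lt.le hzt, hy]
        obtain ⟨i, h1, h2, h3⟩ := hyz.covers (c w) (hk w le_rfl)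
        exact hright i (by omega) (by omega) h3
      · exact runFirst_eq_self fun j hj => hright j (by have := hw.lt; omega) (by omega)

end Links

/-- The memory represents a state of the search for links. -/
def LinksMem (c : ℕ → ℕ) (n k : ℕ) (m : Memory) : Prop :=
  m.nat 0 0 = n ∧ m.nat 0 1 = k ∧ m.nat colorArr = c ∧
    (∀ t < n, m.nat firstArr t = runFirst c t) ∧ m.nat winEnd 0 ≤ n ∧
    Seen c (m.nat winEnd 0) (m.nat numColors 0) (m.nat seenArr) ∧
    Links c k (m.nat winEnd 0) (m.nat winStart 0) (m.nat succArr) (m.nat predArr)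

theorem wp_linksBody {c : ℕ → ℕ} {n k : ℕ} (hk : ∀ i < n, c i < k) {m : Memory}
    (hm : LinksMem c n k m) (hlt : m.nat winEnd 0 < n) :
    linksBody.wp (fun m' => LinksMem c n k m' ∧
      (n - m'.nat winEnd 0) + (n - m'.nat winStart 0) <
        (n - m.nat winEnd 0) + (n - m.nat winStart 0)) m := by
  obtain ⟨hn, hk0, hc, hf, hle, hs, h⟩ := hm
  obtain ⟨e, he⟩ : ∃ e, m.nat winEnd 0 = e := ⟨_, rfl⟩
  obtain ⟨s, hs0⟩ : ∃ s, m.nat winStart 0 = s := ⟨_, rfl⟩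
  rw [he] at hlt hle hs h
  rw [hs0] at h
  have hke : ∀ i ≤ e, c i < k := fun i hi => hk i (by omega)
  refine ⟨?_, ?_⟩
  · rintro ⟨hse, hpop⟩
    simp [he, hs0, hc] at hse hpop
    have := h.pop hse (by
      rcases hpop with hpop | hpop
      · obtain ⟨t, ht⟩ := Nat.exists_eq_succ_of_ne_zero (hs.ne_zero s hse)
        obtain ⟨h1, h2, h3⟩ := hs.last _ t ht
        refine ⟨t, ?_, h1.le, h2⟩
        by_contra hts
        rcases lt_or_eq_of_le (not_lt.1 hts) with hts | rfl
        · exact h3 s hts hse rfl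
        · exact hpop ht
      · exact ⟨e, hse, le_rfl, hpop.symm⟩)
    simp [LinksMem, hn, hk0, hc, he, hs0, hle]
    exact ⟨⟨hf, hs, this⟩, by omega⟩
  · intro hpop
    simp [he, hs0, hc] at hpop
    have hleft : ∀ i, s < i → i ≤ e → c i ≠ c s := fun i hi hie => by
      obtain ⟨h1, h2⟩ := hpop (by omega)
      rcases hie.eq_or_lt with rfl | hie
      · exact Ne.symm h2
      · exact (hs.last _ s h1).2.2 i hi hie
    have hstep := hs.step
    have hcov := hstep.covers_iff hke
    have hfs : m.nat firstArr s = runFirst c s := hf s (by have := h.s_le; omega)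
    refine ⟨fun h0 => ?_, fun h0 => ?_⟩ <;> simp [he, hc] at h0 <;>
      simp only [h0, reduceIte] at hstep hcov <;> refine ⟨fun hb => ?_, fun hb => ?_⟩ <;>
      simp [he, hs0, hk0, hc, hfs, hf e hlt, hcov] at hb <;>
      simp [LinksMem, hn, hk0, hc, he, hs0, hfs]
    · exact ⟨⟨hf, hlt, hstep, h.extend_link hke hleft hb.1.1 hb.1.2 hb.2.1 hb.2.2⟩, by omega⟩
    · exact ⟨⟨hf, hlt, hstep, h.extend_no_link hke hleft fun ⟨h1, h2, h3, h4⟩ => hb h1 h2 h3 h4⟩,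
        by omega⟩
    · exact ⟨⟨hf, hlt, hstep, h.extend_link hke hleft hb.1.1 hb.1.2 hb.2.1 hb.2.2⟩, by omega⟩
    · exact ⟨⟨hf, hlt, hstep, h.extend_no_link hke hleft fun ⟨h1, h2, h3, h4⟩ => hb h1 h2 h3 h4⟩,
        by omega⟩

theorem exists_runs_links {c : ℕ → ℕ} {n k : ℕ} (hk : ∀ i < n, c i < k) {m : Memory}
    (hm : LinksMem c n k m) :
    ∃ t m', Runs (upTo winEnd linksBody) m t m' ∧
      t ≤ (2 * n + 2) * ((Test.natLt (nvar winEnd) sizeExpr).cost + 1 + linksBody.bound) ∧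
      ∃ s, Links c k n s (m'.nat succArr) (m'.nat predArr) := by
  obtain ⟨t, m', hr, ht, hI, hex⟩ := exists_runs_while (b := .natLt (nvar winEnd) sizeExpr)
    (p := linksBody) (LinksMem c n k)
    (fun m' => (n - m'.nat winEnd 0) + (n - m'.nat winStart 0))
    (fun m' h hlt => wp_linksBody hk h (by simpa [h.1] using hlt)) hm
  refine ⟨t, m', hr, ht.trans (Nat.mul_le_mul_right _ (by omega)), ?_⟩
  obtain ⟨hn, -, -, -, hle, -, h⟩ := hI
  simp [hn] at hex
  rw [le_antisymm hle hex] at h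
  exact ⟨_, h⟩

/-! ### The order of the runs -/

theorem exists_lt_succ_update_eq {α : Type*} (f : ℕ → α) (q : ℕ) (a b : α) :
    (∃ t < q + 1, Function.update f q a t = b) ↔ (∃ t < q, f t = b) ∨ a = b := by
  constructor
  · rintro ⟨t, ht, h⟩
    rw [Function.update_apply] at h
    split_ifs at h with htq
    · exact Or.inr h
    · exact Or.inl ⟨t, by omega, h⟩
  · rintro (⟨t, ht, h⟩ | h)
    · exact ⟨t, by omega, by rwa [Function.update_of_ne ht.ne]⟩
    · exact ⟨q, by omega, by rwa [Function.update_self]⟩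

/-- A statement about the entries of an array survives when an entry is appended. -/
theorem forall_lt_succ_update {α : Type*} {f : ℕ → α} {q : ℕ} {a : α} {P : ℕ → α → Prop}
    (h : ∀ t < q, P t (f t)) (ha : P q a) : ∀ t < q + 1, P t (Function.update f q a t) := by
  intro t ht
  rcases Nat.lt_succ_iff_lt_or_eq.1 ht with ht | rfl
  · rw [Function.update_of_ne ht.ne]; exact h t ht
  · rwa [Function.update_self]

/-- State of the enumeration `ord` of the vertices `0, …, n - 1` along the paths given by the
successor map `nx` and the predecessor map `pr`, both with values increased by one. The first `q`
entries are fixed, the next one is `v - 1` if `v ≠ 0`, and paths that start at vertices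
`< z` have been considered. The shift `sh` is constant on paths and grows by `D` between them; `o`
is the current shift. An index that is not the first member of its run has no links and is a path
of its own; its position is irrelevant. The bounds `lo`, `up` belong to intervals with left
endpoints `x` and runs whose last members are given by `g`. -/
structure OrderState (nx pr g : ℕ → ℕ) (x : ℕ → ℝ) (n : ℕ) (D : ℝ) (ord : ℕ → ℕ)
    (sh lo up : ℕ → ℝ) (q z v : ℕ) (o : ℝ) : Prop where
  scan_le : z ≤ n
  lt : ∀ t < q, ord t < n
  inj : ∀ t < q, ∀ t' < q, ord t = ord t' → t = t'
  start : ∀ w < n, pr w = 0 → ((∃ t < q, ord t = w) ∨ v = w + 1 ↔ w < z)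
  linked : ∀ u w, nx u = w + 1 → ((∃ t < q, ord t = w) ∨ v = w + 1 ↔ ∃ t < q, ord t = u)
  walk : ∀ w, v = w + 1 → w < n ∧ ¬ ∃ t < q, ord t = w
  lower : ∀ t < q, lo t = x (g (ord t)) + sh t
  upper : ∀ t < q, up t = x (ord t) + 1 + sh t
  next : ∀ t, t + 1 < q → nx (ord t) = ord (t + 1) + 1 ∧ sh (t + 1) = sh t ∨
    nx (ord t) = 0 ∧ sh (t + 1) = sh t + D
  last : ∀ t, t + 1 = q → v = nx (ord t) ∧ o = sh t ∨
    nx (ord t) = 0 ∧ v ≠ 0 ∧ o = sh t + D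

/-- An enumeration of the vertices along the paths, see `OrderState`. -/
structure PathOrder (nx g : ℕ → ℕ) (x : ℕ → ℝ) (n : ℕ) (D : ℝ) (ord : ℕ → ℕ)
    (sh lo up : ℕ → ℝ) : Prop where
  lt : ∀ t < n, ord t < n
  inj : ∀ t < n, ∀ t' < n, ord t = ord t' → t = t'
  surj : ∀ w < n, ∃ t < n, ord t = w
  lower : ∀ t < n, lo t = x (g (ord t)) + sh t
  upper : ∀ t < n, up t = x (ord t) + 1 + sh t
  next : ∀ t, t + 1 < n → nx (ord t) = ord (t + 1) + 1 ∧ sh (t + 1) = sh t ∨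
    nx (ord t) = 0 ∧ sh (t + 1) = sh t + D
  last : ∀ t, t + 1 = n → nx (ord t) = 0

/-- Linked vertices are neighbors in the order. -/
theorem PathOrder.exists_of_link {nx g : ℕ → ℕ} {x : ℕ → ℝ} {n : ℕ} {D : ℝ} {ord : ℕ → ℕ}
    {sh lo up : ℕ → ℝ} (h : PathOrder nx g x n D ord sh lo up) {u w : ℕ} (hu : u < n)
    (huw : nx u = w + 1) :
    ∃ t, t + 1 < n ∧ ord t = u ∧ ord (t + 1) = w ∧ sh (t + 1) = sh t := by
  obtain ⟨t, ht, rfl⟩ := h.surj u hu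
  rcases (Nat.succ_le_of_lt ht).eq_or_lt with hl | hl
  · have := h.last t hl
    omega
  · rcases h.next t hl with ⟨h1, h2⟩ | ⟨h1, -⟩
    · exact ⟨t, hl, rfl, by omega, h2⟩
    · omega

namespace OrderState

variable {nx pr g : ℕ → ℕ} {x : ℕ → ℝ} {n : ℕ} {D : ℝ} {ord : ℕ → ℕ}
  {sh lo up : ℕ → ℝ} {q z v : ℕ} {o : ℝ}

theorem init : OrderState nx pr g x n D ord sh lo up 0 0 0 o where
  scan_le := Nat.zero_le n
  lt t ht := by omega
  inj t ht := by omega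
  start w _ _ := by simp
  linked u w _ := by simp
  walk w hw := by omega
  lower t ht := by omega
  upper t ht := by omega
  next t ht := by omega
  last t ht := by omega

theorem le (h : OrderState nx pr g x n D ord sh lo up q z v o) : q ≤ n := by
  have := Finset.card_le_card_of_injOn (s := Finset.range q) (t := Finset.range n) ord
    (fun t ht => by simpa using h.lt t (by simpa using ht))
    (fun t ht t' ht' => h.inj t (by simpa using ht) t' (by simpa using ht'))
  simpa using this

/-- Place the vertex `w` and walk on. -/
theorem place (hnp : ∀ u w, nx u = w + 1 ↔ pr w = u + 1) (hlt : ∀ u w, nx u = w + 1 → u < w ∧ w < n)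
    {w : ℕ} (h : OrderState nx pr g x n D ord sh lo up q z (w + 1) o) :
    OrderState nx pr g x n D (Function.update ord q w) (Function.update sh q o)
      (Function.update lo q (x (g w) + o)) (Function.update up q (x w + 1 + o)) (q + 1) z
      (nx w) o := by
  obtain ⟨hwn, hw⟩ := h.walk w rfl
  have old : ∀ {α : Type} (f : ℕ → α) (a : α) t, t < q → Function.update f q a t = f t :=
    fun f a t ht => Function.update_of_ne ht.ne _ _
  refine ⟨h.scan_le, ?_, ?_, ?_, ?_, ?_, ?_, ?_, ?_, ?_⟩
  · exact forall_lt_succ_update (P := fun _ y => y < n) h.lt hwn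
  · intro t ht t' ht' heq
    simp only [Function.update_apply] at heq
    split_ifs at heq with h1 h2 h2
    · omega
    · exact absurd ⟨t', by omega, heq.symm⟩ hw
    · exact absurd ⟨t, by omega, heq⟩ hw
    · exact h.inj t (by omega) t' (by omega) heq
  · intro y hy hpr
    rw [exists_lt_succ_update_eq, ← h.start y hy hpr]
    have : nx w ≠ y + 1 := fun h' => by
      rw [hnp] at h'
      omega
    simp [this]
  · intro u y huy
    have h1 := h.linked u y huy
    have h2 : nx w = y + 1 ↔ w = u := by
      refine ⟨fun h' => ?_, fun h' => h' ▸ huy⟩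
      rw [hnp] at h' huy
      omega
    rw [exists_lt_succ_update_eq, exists_lt_succ_update_eq, h2, ← h1]
    simp
  · intro y hy
    obtain ⟨hwy, hyn⟩ := hlt w y hy
    refine ⟨hyn, ?_⟩
    rw [exists_lt_succ_update_eq]
    rintro (hE | rfl)
    · exact hw ((h.linked w y hy).1 (Or.inl hE))
    · omega
  · intro t ht
    rcases Nat.lt_succ_iff_lt_or_eq.1 ht with ht | rfl
    · simp only [old _ _ t ht, h.lower t ht]
    · simp
  · intro t ht
    rcases Nat.lt_succ_iff_lt_or_eq.1 ht with ht | rfl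
    · simp only [old _ _ t ht, h.upper t ht]
    · simp
  · intro t ht
    rcases Nat.lt_succ_iff_lt_or_eq.1 ht with ht | rfl
    · simpa only [old _ _ t (by omega), old _ _ _ ht] using h.next t ht
    · simp only [old _ _ t (by omega), Function.update_self]
      exact (h.last t rfl).imp (fun h' => ⟨h'.1.symm, h'.2⟩) (fun h' => ⟨h'.1, h'.2.2⟩)
  · intro t ht
    obtain rfl : t = q := by omega
    exact Or.inl (by simp)

/-- Start a new path at the vertex `z`. -/
theorem start_path (hnp : ∀ u w, nx u = w + 1 ↔ pr w = u + 1)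
    (h : OrderState nx pr g x n D ord sh lo up q z 0 o) (hz : z < n) (hpr : pr z = 0) :
    OrderState nx pr g x n D ord sh lo up q (z + 1) (z + 1) (o + D) := by
  refine ⟨hz, h.lt, h.inj, ?_, ?_, ?_, h.lower, h.upper, h.next, ?_⟩
  · intro w hw hw0
    have := h.start w hw hw0
    simp only [(Nat.succ_ne_zero w).symm, or_false] at this
    rw [this]
    omega
  · intro u w huw
    rw [← h.linked u w huw]
    have : z ≠ w := by
      rintro rfl
      rw [hnp] at huw
      omega
    simp [this]
  · intro w hw
    obtain rfl : z = w := by omega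
    refine ⟨hz, fun hE => ?_⟩
    have := (h.start z hz hpr).1 (Or.inl hE)
    omega
  · intro t ht
    rcases h.last t ht with ⟨h1, h2⟩ | ⟨-, h2, -⟩
    · exact Or.inr ⟨h1.symm, by omega, by rw [h2]⟩
    · exact absurd rfl h2

theorem skip (h : OrderState nx pr g x n D ord sh lo up q z 0 o) (hz : z < n) (hpr : pr z ≠ 0) :
    OrderState nx pr g x n D ord sh lo up q (z + 1) 0 o := by
  refine ⟨hz, h.lt, h.inj, fun w hw hw0 => ?_, h.linked, h.walk, h.lower, h.upper, h.next, h.last⟩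
  rw [h.start w hw hw0]
  have : w ≠ z := by
    rintro rfl
    exact hpr hw0
  omega

theorem pathOrder (hnp : ∀ u w, nx u = w + 1 ↔ pr w = u + 1)
    (hlt : ∀ u w, nx u = w + 1 → u < w ∧ w < n)
    (h : OrderState nx pr g x n D ord sh lo up q n 0 o) :
    PathOrder nx g x n D ord sh lo up := by
  have surj : ∀ w < n, ∃ t < q, ord t = w := by
    intro w
    induction w using Nat.strong_induction_on with
    | _ w ih =>
      intro hw
      rcases Nat.eq_zero_or_pos (pr w) with h0 | h0
      · simpa using (h.start w hw h0).2 hw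
      · obtain ⟨u, hu⟩ := Nat.exists_eq_succ_of_ne_zero h0.ne'
        have huw := (hnp u w).2 hu
        have := (hlt u w huw).1
        simpa using (h.linked u w huw).2 (ih u this (by omega))
  have hq : q = n := by
    refine le_antisymm h.le ?_
    have := Finset.card_le_card_of_surjOn (s := Finset.range q) (t := Finset.range n) ord
      (fun w hw => by simpa using surj w (by simpa using hw))
    simpa using this
  subst hq
  refine ⟨h.lt, h.inj, surj, h.lower, h.upper, h.next, fun t ht => ?_⟩
  rcases h.last t ht with ⟨h1, -⟩ | ⟨h1, -⟩
  · exact h1.symm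
  · exact h1

end OrderState

/-- The memory represents a state of the enumeration of the runs. -/
def OrderMem (nx pr g : ℕ → ℕ) (x : ℕ → ℝ) (n : ℕ) (W : ℝ) (m : Memory) : Prop :=
  m.nat 0 0 = n ∧ m.nat succArr = nx ∧ m.nat predArr = pr ∧ m.nat lastArr = g ∧
    m.real leftArr = x ∧ m.real widthVar 0 = W ∧
    OrderState nx pr g x n (W + W) (m.nat orderArr) (m.real shiftArr) (m.real lowerArr)
      (m.real upperArr) (m.nat numPlaced 0) (m.nat scanIdx 0) (m.nat walker 0) (m.real shiftVar 0)

theorem wp_orderBody {nx pr g : ℕ → ℕ} {x : ℕ → ℝ} {n : ℕ} {W : ℝ}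
    (hnp : ∀ u w, nx u = w + 1 ↔ pr w = u + 1) (hlt : ∀ u w, nx u = w + 1 → u < w ∧ w < n)
    {m : Memory} (hm : OrderMem nx pr g x n W m) (hb : 0 < m.nat walker 0 ∨ m.nat scanIdx 0 < n) :
    orderBody.wp (fun m' => OrderMem nx pr g x n W m' ∧
      (n - m'.nat numPlaced 0) + (n - m'.nat scanIdx 0) <
        (n - m.nat numPlaced 0) + (n - m.nat scanIdx 0)) m := by
  obtain ⟨hn, hnx, hpr, hg, hx, hW, h⟩ := hm
  refine ⟨fun hw => ?_, fun hw => ?_⟩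
  · simp at hw
    obtain ⟨w, hw⟩ := Nat.exists_eq_succ_of_ne_zero hw.ne'
    rw [hw] at h
    have h' := h.place hnp hlt
    have := h'.le
    simp [OrderMem, hn, hnx, hpr, hg, hx, hW, hw]
    exact ⟨h', by omega⟩
  · simp at hw
    rw [hw] at h
    have hz : m.nat scanIdx 0 < n := by omega
    refine ⟨fun h0 => ?_, fun h0 => ?_⟩
    · simp [hpr] at h0
      simp [OrderMem, hn, hnx, hpr, hg, hx, hW]
      exact ⟨h.start_path hnp hz h0, by omega⟩
    · simp [hpr] at h0
      simp [OrderMem, hn, hnx, hpr, hg, hx, hW, hw]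
      exact ⟨h.skip hz h0, by omega⟩

theorem exists_runs_order {nx pr g : ℕ → ℕ} {x : ℕ → ℝ} {n : ℕ} {W : ℝ}
    (hnp : ∀ u w, nx u = w + 1 ↔ pr w = u + 1) (hlt : ∀ u w, nx u = w + 1 → u < w ∧ w < n)
    {m : Memory} (hm : OrderMem nx pr g x n W m) :
    ∃ t m', Runs orderLoop m t m' ∧
      t ≤ (2 * n + 2) * ((Test.or (.natLt (.const 0) (nvar walker))
        (.natLt (nvar scanIdx) sizeExpr)).cost + 1 + orderBody.bound) ∧
      PathOrder nx g x n (W + W) (m'.nat orderArr) (m'.real shiftArr) (m'.real lowerArr)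
        (m'.real upperArr) := by
  obtain ⟨t, m', hr, ht, hI, hex⟩ := exists_runs_while
    (b := .or (.natLt (.const 0) (nvar walker)) (.natLt (nvar scanIdx) sizeExpr))
    (p := orderBody) (OrderMem nx pr g x n W)
    (fun m' => (n - m'.nat numPlaced 0) + (n - m'.nat scanIdx 0))
    (fun m' h hb => wp_orderBody hnp hlt h (by simpa [h.1] using hb)) hm
  refine ⟨t, m', hr, ht.trans (Nat.mul_le_mul_right _ (by omega)), ?_⟩
  obtain ⟨hn, -, -, -, -, -, h⟩ := hI
  simp [hn] at hex
  rw [hex.1, le_antisymm h.scan_le hex.2] at h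
  exact h.pathOrder hnp hlt

/-! ### Positions and output -/

/-- The memory represents a state of the greedy placement. -/
def SpreadMem (ord : ℕ → ℕ) (l sh : ℕ → ℝ) (L : ℝ) (n : ℕ) (m : Memory) : Prop :=
  m.nat 0 0 = n ∧ m.nat orderArr = ord ∧ m.real lowerArr = l ∧ m.real shiftArr = sh ∧
    m.real gapVar 0 = L ∧ m.nat spreadIdx 0 ≤ n ∧
    m.real positionVar 0 = greedy l L (m.nat spreadIdx 0) ∧
    ∀ t < m.nat spreadIdx 0, m.real posArr (ord t) = greedy l L (t + 1) - sh t

theorem wp_spreadBody {ord : ℕ → ℕ} {l sh : ℕ → ℝ} {L : ℝ} {n : ℕ}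
    (hinj : ∀ t < n, ∀ t' < n, ord t = ord t' → t = t') {m : Memory}
    (hm : SpreadMem ord l sh L n m) (hlt : m.nat spreadIdx 0 < n) :
    spreadBody.wp (fun m' => SpreadMem ord l sh L n m' ∧
      n - m'.nat spreadIdx 0 < n - m.nat spreadIdx 0) m := by
  obtain ⟨hn, ho, hl, hs, hL, hle, hp, hP⟩ := hm
  obtain ⟨i, hi⟩ : ∃ i, m.nat spreadIdx 0 = i := ⟨_, rfl⟩
  rw [hi] at hlt hle hp hP
  have key : ∀ y, y = greedy l L (i + 1) - sh i → ∀ t < i + 1,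
      Function.update (m.real posArr) (ord i) y (ord t) = greedy l L (t + 1) - sh t := by
    intro y hy t ht
    rcases Nat.lt_succ_iff_lt_or_eq.1 ht with ht | rfl
    · rw [Function.update_of_ne, hP t ht]
      intro heq
      have := hinj t (by omega) i hlt heq
      omega
    · rw [Function.update_self, hy]
  refine ⟨fun hb => ?_, fun hb => ?_⟩
  · simp [hi, hp, hL, hl] at hb
    have hg : greedy l L (i + 1) = l i := max_eq_left hb.le
    simp [SpreadMem, hn, ho, hl, hs, hL, hi, hg]
    exact ⟨⟨hlt, fun t ht => key _ (by rw [hg]) t (Nat.lt_succ_of_le ht)⟩, by omega⟩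
  · simp [hi, hp, hL, hl] at hb
    have hg : greedy l L (i + 1) = greedy l L i + L := max_eq_right hb
    simp [SpreadMem, hn, ho, hl, hs, hL, hi, hg, hp]
    exact ⟨⟨hlt, fun t ht => key _ (by rw [hg]) t (Nat.lt_succ_of_le ht)⟩, by omega⟩

theorem exists_runs_spread {ord : ℕ → ℕ} {l sh : ℕ → ℝ} {L : ℝ} {n : ℕ}
    (hinj : ∀ t < n, ∀ t' < n, ord t = ord t' → t = t') {m : Memory}
    (hm : SpreadMem ord l sh L n m) :
    ∃ t m', Runs (upTo spreadIdx spreadBody) m t m' ∧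
      t ≤ (2 * n + 2) * ((Test.natLt (nvar spreadIdx) sizeExpr).cost + 1 + spreadBody.bound) ∧
      ∀ t < n, m'.real posArr (ord t) = greedy l L (t + 1) - sh t := by
  obtain ⟨t, m', hr, ht, hI, hex⟩ := exists_runs_while (b := .natLt (nvar spreadIdx) sizeExpr)
    (p := spreadBody) (SpreadMem ord l sh L n) (fun m' => n - m'.nat spreadIdx 0)
    (fun m' h hlt => wp_spreadBody hinj h (by simpa [h.1] using hlt)) hm
  refine ⟨t, m', hr, ht.trans (Nat.mul_le_mul_right _ (by omega)), ?_⟩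
  obtain ⟨hn, -, -, -, -, hle, -, h⟩ := hI
  simp [hn] at hex
  rwa [le_antisymm hle hex] at h

/-- The memory represents a state of the computation of the output. -/
def OutputMem (f : ℕ → ℕ) (x P : ℕ → ℝ) (n : ℕ) (m : Memory) : Prop :=
  m.nat 0 0 = n ∧ m.nat firstArr = f ∧ m.real leftArr = x ∧ m.real posArr = P ∧
    m.nat outIdx 0 ≤ n ∧ ∀ i < m.nat outIdx 0, m.real outArr i = min (P (f i)) (x i + 1)

theorem wp_outputBody {f : ℕ → ℕ} {x P : ℕ → ℝ} {n : ℕ} {m : Memory} (hm : OutputMem f x P n m)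
    (hlt : m.nat outIdx 0 < n) :
    outputBody.wp (fun m' => OutputMem f x P n m' ∧ n - m'.nat outIdx 0 < n - m.nat outIdx 0)
      m := by
  obtain ⟨hn, hf, hx, hP, hle, h⟩ := hm
  have key := fun a ha =>
    forall_lt_succ_update (P := fun i y => y = min (P (f i)) (x i + 1)) (a := a) h ha
  refine ⟨fun hb => ?_, fun hb => ?_⟩ <;> simp [hf, hx, hP] at hb <;>
    simp [OutputMem, hn, hf, hx, hP]
  · exact ⟨⟨hlt, fun i hi => key _ (min_eq_left hb.le).symm i (Nat.lt_succ_of_le hi)⟩, by omega⟩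
  · exact ⟨⟨hlt, fun i hi => key _ (min_eq_right hb).symm i (Nat.lt_succ_of_le hi)⟩, by omega⟩

theorem exists_runs_output {f : ℕ → ℕ} {x P : ℕ → ℝ} {n : ℕ} {m : Memory}
    (hm : OutputMem f x P n m) :
    ∃ t m', Runs (upTo outIdx outputBody) m t m' ∧
      t ≤ (2 * n + 2) * ((Test.natLt (nvar outIdx) sizeExpr).cost + 1 + outputBody.bound) ∧
      ∀ i < n, m'.real outArr i = min (P (f i)) (x i + 1) := by
  obtain ⟨t, m', hr, ht, hI, hex⟩ := exists_runs_while (b := .natLt (nvar outIdx) sizeExpr)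
    (p := outputBody) (OutputMem f x P n) (fun m' => n - m'.nat outIdx 0)
    (fun m' h hlt => wp_outputBody h (by simpa [h.1] using hlt)) hm
  refine ⟨t, m', hr, ht.trans (Nat.mul_le_mul_right _ (by omega)), ?_⟩
  obtain ⟨hn, -, -, -, hle, h⟩ := hI
  simp [hn] at hex
  rwa [le_antisymm hle hex] at h

/-! ### Optimality -/

/-- Intervals `[x i, x i + 1]`, `i < n`, sorted by their left endpoints, with colors `c i < k`
such that intervals of distinct colors are disjoint. -/
structure Separated (n k : ℕ) (x : ℕ → ℝ) (c : ℕ → ℕ) : Prop where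
  color_lt : ∀ i < n, c i < k
  mono : ∀ i j, i ≤ j → j < n → x i ≤ x j
  lt : ∀ i j, i < j → j < n → c i ≠ c j → x i + 1 < x j

/-- `r` chooses a point in each of the intervals. -/
def Realizes (n : ℕ) (x r : ℕ → ℝ) : Prop := ∀ i < n, x i ≤ r i ∧ r i ≤ x i + 1

/-- The interval `[a, b]` is color-spanning for the points `r i`, `i < n`. -/
def Spans (n k : ℕ) (c : ℕ → ℕ) (r : ℕ → ℝ) (a b : ℝ) : Prop :=
  a ≤ b ∧ ∀ y < k, ∃ i < n, c i = y ∧ a ≤ r i ∧ r i ≤ b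

theorem isColorSpanning_iff {n k : ℕ} {col : Fin n → Fin k} {r : Fin n → ℝ} {c : ℕ → ℕ}
    {r' : ℕ → ℝ} (hc : ∀ i : Fin n, c i = col i) (hr : ∀ i : Fin n, r' i = r i) {a b : ℝ} :
    IsColorSpanning col r a b ↔ Spans n k c r' a b := by
  refine and_congr_right fun _ => ⟨fun h y hy => ?_, fun h y => ?_⟩
  · obtain ⟨i, hi, h1⟩ := h ⟨y, hy⟩
    exact ⟨i, i.2, by rw [hc, hi], by rwa [hr]⟩
  · obtain ⟨i, hin, hi, h1⟩ := h y y.2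
    refine ⟨⟨i, hin⟩, Fin.ext ?_, ?_⟩
    · rw [← hc]; exact hi
    · rw [← hr]; exact h1

namespace Separated

variable {n k : ℕ} {x r : ℕ → ℝ} {c : ℕ → ℕ}

theorem lt_of_color_ne (hS : Separated n k x c) (hr : Realizes n x r) {i j : ℕ} (hij : i < j)
    (hj : j < n) (hc : c i ≠ c j) : r i < r j := by
  linarith [hS.lt i j hij hj hc, (hr i (by omega)).2, (hr j hj).1]

/-- Representatives of different runs are sorted, even if the runs have the same color. -/
theorem lt_of_runFirst_ne (hS : Separated n k x c) (hr : Realizes n x r) {i j : ℕ} (hij : i < j)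
    (hj : j < n) (hrun : runFirst c i ≠ runFirst c j) : r i < r j := by
  obtain ⟨t, hit, htj, hc⟩ := exists_color_ne_of_runFirst_ne hij.le hrun
  have htj' : t < j := lt_of_le_of_ne htj (by rintro rfl; exact hc rfl)
  by_cases hci : c i = c j
  · have hit' : i < t := lt_of_le_of_ne hit (by rintro rfl; exact hc hci)
    exact (hS.lt_of_color_ne hr hit' (by omega) (by rw [hci]; exact hc.symm)).trans
      (hS.lt_of_color_ne hr htj' hj hc)
  · exact hS.lt_of_color_ne hr hij hj hci

/-- The representatives of the two ends of a window of indices span all colors. -/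
theorem spans_of_covers (hS : Separated n k x c) (hr : Realizes n x r) {i j : ℕ} (hij : i < j)
    (hj : j < n) (hc : c i ≠ c j) (hcov : Covers c k i j) : Spans n k c r (r i) (r j) := by
  have hlt := hS.lt_of_color_ne hr hij hj hc
  refine ⟨hlt.le, fun y hy => ?_⟩
  by_cases hyi : c i = y
  · exact ⟨i, by omega, hyi, le_rfl, hlt.le⟩
  by_cases hyj : c j = y
  · exact ⟨j, hj, hyj, hlt.le, le_rfl⟩
  obtain ⟨t, h1, h2, rfl⟩ := hcov y hy
  have h3 : i < t := lt_of_le_of_ne h1 (by rintro rfl; exact hyi rfl)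
  have h4 : t < j := lt_of_le_of_ne h2 (by rintro rfl; exact hyj rfl)
  exact ⟨t, by omega, rfl, (hS.lt_of_color_ne hr h3 (by omega) hyi).le,
    (hS.lt_of_color_ne hr h4 hj (Ne.symm hyj)).le⟩

/-- The last member of a linked run is the left end of the window that belongs to the link. -/
theorem last_eq {f g : ℕ → ℕ} (hR : RunsState c n f g) {s w : ℕ} (hw : Window c k s w)
    (hwn : w < n) : g (runFirst c s) = s := by
  obtain ⟨-, h1, -, h2⟩ := hR s (hw.lt.trans hwn)
  by_contra hne
  rcases le_total (g (runFirst c s)) w with h3 | h3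
  · exact hw.left _ (by omega) h3 (color_eq_of_runFirst_eq h2)
  · refine hw.left w hw.lt le_rfl (color_eq_of_runFirst_eq ?_)
    rw [runFirst_eq_between h2.symm hw.lt.le h3, h2]

variable {f g nx pr ord : ℕ → ℕ} {sh lo up : ℕ → ℝ} {z : ℕ}

/-- If all color-spanning intervals of some realization have length at least `M`, then the runs
can be placed with gap `M`: along a link, the gap between two runs is a color-spanning interval,
and between different paths, the shift is large enough. -/
theorem feasible_of_spans (hS : Separated n k x c) (hr : Realizes n x r)
    (hR : RunsState c n f g) (hg : ∀ v, g v < n) (hL : Links c k n z nx pr)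
    (hP : PathOrder nx g x n ((x (n - 1) + 1 - x 0) + (x (n - 1) + 1 - x 0)) ord sh lo up) {M : ℝ}
    (hMW : M ≤ x (n - 1) + 1 - x 0) (hM : ∀ a b, Spans n k c r a b → M ≤ b - a) :
    Feasible lo up n M := by
  have hlow : ∀ i < n, x 0 ≤ r i := fun i hi => (hS.mono 0 i (Nat.zero_le i) hi).trans (hr i hi).1
  have hupp : ∀ i < n, r i ≤ x (n - 1) + 1 := fun i hi => by
    linarith [(hr i hi).2, hS.mono i (n - 1) (by omega) (by omega)]
  have step : ∀ t, t + 1 < n → ∀ y, y = ord t ∨ y = g (ord t) →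
      r y + sh t + M ≤ r (ord (t + 1)) + sh (t + 1) := by
    intro t ht y hy
    have hyn : y < n := by
      rcases hy with rfl | rfl
      · exact hP.lt t (by omega)
      · exact hg _
    rcases hP.next t ht with ⟨h1, h2⟩ | ⟨-, h2⟩
    · obtain ⟨hwn, -, s, hs, hw⟩ := hL.sound _ _ h1
      have hys : y ≤ s ∧ c y = c s := by
        rcases hy with rfl | rfl
        · rw [← hs]
          exact ⟨runFirst_le c s, color_runFirst c s⟩
        · rw [← hs, last_eq hR hw hwn]
          exact ⟨le_rfl, rfl⟩
      have := hM _ _ (hS.spans_of_covers hr (hys.1.trans_lt hw.lt) hwn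
        (by rw [hys.2]; exact (hw.left _ hw.lt le_rfl).symm) (hw.covers.mono hys.1 le_rfl))
      linarith
    · linarith [hlow _ (hP.lt _ ht), hupp y hyn]
  intro i j hij hj
  have key : x (g (ord i)) + sh i + ((j : ℝ) - i) * M ≤ r (ord j) + sh j := by
    induction j, hij using Nat.le_induction with
    | base =>
      have h1 := step i hj _ (Or.inr rfl)
      have h2 := (hr _ (hg (ord i))).1
      push_cast
      linarith
    | succ j hij ih =>
      have h1 := step j hj _ (Or.inl rfl)
      have h2 := ih (by omega)
      push_cast
      linarith
  rw [hP.lower i (by omega), hP.upper j hj]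
  linarith [(hr _ (hP.lt j hj)).2]

/-- The realization computed from the positions `p` of the runs. -/
theorem realizes_min (hS : Separated n k x c) (hR : RunsState c n f g)
    {D L : ℝ} (hP : PathOrder nx g x n D ord sh lo up) {p : ℕ → ℝ}
    (hp : ∀ t < n, p (ord t) = greedy lo L (t + 1) - sh t) :
    Realizes n x fun i => min (p (runFirst c i)) (x i + 1) := by
  refine fun i hi => ⟨le_min ?_ (by linarith), min_le_right _ _⟩
  obtain ⟨-, h1, h2, -⟩ := hR i hi
  obtain ⟨t, ht, hti⟩ := hP.surj (runFirst c i) ((runFirst_le c i).trans_lt hi)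
  have h3 := le_greedy lo L t
  rw [← hti, hp t ht]
  rw [hP.lower t ht, hti] at h3
  linarith [hS.mono i _ h1 h2]

/-- Unless there is just one color, every color-spanning interval reaches from a run at least to
a run linked to it, hence has length at least `L`. -/
theorem le_of_spans (hS : Separated n k x c) (hn : 0 < n) (hR : RunsState c n f g)
    (hL : Links c k n z nx pr) {D L : ℝ} (hP : PathOrder nx g x n D ord sh lo up)
    (hfeas : Feasible lo up n L) {p : ℕ → ℝ}
    (hp : ∀ t < n, p (ord t) = greedy lo L (t + 1) - sh t) {a b : ℝ}
    (hab : Spans n k c (fun i => min (p (runFirst c i)) (x i + 1)) a b) :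
    L ≤ b - a ∨ k = 1 := by
  classical
  have hr := hS.realizes_min hR hP hp
  set r : ℕ → ℝ := fun i => min (p (runFirst c i)) (x i + 1) with hrdef
  -- the first and the last index with a representative in `[a, b]`
  set T := (Finset.range n).filter fun i => a ≤ r i ∧ r i ≤ b with hT
  have hmem : ∀ i, i ∈ T ↔ i < n ∧ a ≤ r i ∧ r i ≤ b := fun i => by simp [hT]
  have hk : 0 < k := (Nat.zero_le _).trans_lt (hS.color_lt 0 hn)
  have hne : T.Nonempty := by
    obtain ⟨i, hi, -, h1⟩ := hab.2 0 hk
    exact ⟨i, (hmem i).2 ⟨hi, h1⟩⟩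
  obtain ⟨hl, hla, -⟩ := (hmem _).1 (T.min'_mem hne)
  obtain ⟨hu, -, hub⟩ := (hmem _).1 (T.max'_mem hne)
  set i₀ := T.min' hne
  set i₁ := T.max' hne
  have hcov : Covers c k i₀ i₁ := fun y hy => by
    obtain ⟨i, hi, hiy, h1⟩ := hab.2 y hy
    exact ⟨i, T.min'_le i ((hmem i).2 ⟨hi, h1⟩), T.le_max' i ((hmem i).2 ⟨hi, h1⟩), hiy⟩
  -- shorten the window first from the right and then from the left
  have hex : ∃ e, Covers c k i₀ e := ⟨i₁, hcov⟩
  obtain ⟨e, he, hemin⟩ : ∃ e, Covers c k i₀ e ∧ ∀ e' < e, ¬ Covers c k i₀ e' :=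
    ⟨Nat.find hex, Nat.find_spec hex, fun e' => Nat.find_min hex⟩
  have hei : e ≤ i₁ := by
    by_contra hlt
    exact hemin i₁ (by omega) hcov
  have hle : ∀ s, Covers c k s e → s ≤ e := fun s hs => by
    obtain ⟨i, h1, h2, -⟩ := hs 0 hk
    omega
  obtain ⟨s, hs0, hs, hsmax⟩ : ∃ s, i₀ ≤ s ∧ Covers c k s e ∧ ¬ Covers c k (s + 1) e := by
    by_contra! hno
    have : ∀ d, Covers c k (i₀ + d) e := fun d => by
      induction d with
      | zero => exact he
      | succ d ih => exact hno _ (Nat.le_add_right _ _) ih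
    have := hle _ (this (e + 1))
    omega
  have hleft : ∀ i, s < i → i ≤ e → c i ≠ c s := fun i hi hie hc => hsmax fun y hy => by
    obtain ⟨j, h1, h2, h3⟩ := hs y hy
    rcases h1.eq_or_lt with rfl | h1
    · exact ⟨i, hi, hie, hc.trans h3⟩
    · exact ⟨j, h1, h2, h3⟩
  have hright : ∀ i, s ≤ i → i < e → c i ≠ c e := fun i hi hie hc =>
    hemin (e - 1) (by omega) fun y hy => by
      obtain ⟨j, h1, h2, h3⟩ := he y hy
      rcases h2.eq_or_lt with rfl | h2
      · exact ⟨i, by omega, by omega, hc.trans h3⟩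
      · exact ⟨j, h1, by omega, h3⟩
  rcases (hle s hs).eq_or_lt with rfl | hse
  · right
    by_contra hk1
    obtain ⟨i, h1, h2, h3⟩ := hs 0 hk
    obtain ⟨j, h4, h5, h6⟩ := hs 1 (by omega)
    obtain rfl : i = j := by omega
    omega
  left
  have hlink := hL.complete s e (by omega) ⟨hse, hs, hleft⟩ hright
  obtain ⟨-, hefirst, -⟩ := hL.sound _ _ hlink
  obtain ⟨t, ht, hts, hte, hsh⟩ := hP.exists_of_link
    ((runFirst_le c s).trans_lt (by omega)) hlink
  have h1 : a ≤ p (runFirst c s) := by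
    refine hla.trans ?_
    by_cases hrun : runFirst c i₀ = runFirst c s
    · rw [← hrun]
      exact min_le_left _ _
    · refine (hS.lt_of_runFirst_ne hr (lt_of_le_of_ne hs0 ?_) (by omega) hrun).le.trans
        (min_le_left _ _)
      rintro rfl
      exact hrun rfl
  have h2 : r e ≤ b := by
    refine le_trans ?_ hub
    by_cases hrun : runFirst c e = runFirst c i₁
    · simp only [hrdef, hrun]
      exact min_le_min_left _ (by linarith [hS.mono e i₁ hei hu])
    · refine (hS.lt_of_runFirst_ne hr (lt_of_le_of_ne hei ?_) hu hrun).le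
      intro h
      exact hrun (by rw [h])
  have h3 : p (runFirst c s) + L ≤ r e := by
    have h4 := hp t (by omega)
    have h5 := hp (t + 1) ht
    rw [hts] at h4
    rw [hte] at h5
    simp only [hrdef, hefirst]
    refine le_min ?_ ?_
    · linarith [LMCSI.greedy_add_le lo L (t + 1)]
    · have h6 := hfeas.greedy_add_le ht
      rw [hP.upper _ ht, hte] at h6
      linarith
  linarith

end Separated

/-- The output of the algorithm is optimal. -/
theorem isSolution_of_pathOrder {n k : ℕ} {x : Fin n → ℝ} {col : Fin n → Fin k} {X : ℕ → ℝ}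
    {c : ℕ → ℕ} (hn : 0 < n) (hX : ∀ i : Fin n, X i = x i) (hc : ∀ i : Fin n, c i = col i)
    (hS : Separated n k X c) {f g nx pr ord : ℕ → ℕ} {sh lo up p : ℕ → ℝ} {z : ℕ} {L : ℝ}
    (hR : RunsState c n f g) (hg : ∀ v, g v < n) (hL : Links c k n z nx pr)
    (hP : PathOrder nx g X n ((X (n - 1) + 1 - X 0) + (X (n - 1) + 1 - X 0)) ord sh lo up)
    (hfeas : Feasible lo up n L)
    (hopt : ∀ M ≤ X (n - 1) + 1 - X 0, Feasible lo up n M → M ≤ L)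
    (hp : ∀ t < n, p (ord t) = greedy lo L (t + 1) - sh t) {r : Fin n → ℝ}
    (hr : ∀ i : Fin n, r i = min (p (runFirst c i)) (X i + 1)) : IsSolution x col r := by
  have hreal := hS.realizes_min hR hP hp
  refine ⟨fun i => ?_, fun r' hr' a' b' hM => ?_⟩
  · rw [hr i, ← hX i]
    exact hreal i i.2
  have hsurj : Function.Surjective col := fun y => by
    obtain ⟨i, hi, -⟩ := hM.1.2 y
    exact ⟨i, hi⟩
  obtain ⟨a, b, hab⟩ := exists_isMCSI col hsurj r
  refine ⟨a, b, hab, ?_⟩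
  obtain ⟨R, hRr⟩ : ∃ R : ℕ → ℝ, ∀ i : Fin n, R i = r' i :=
    ⟨fun i => if h : i < n then r' ⟨i, h⟩ else 0, fun i => by simp⟩
  have hRX : Realizes n X R := fun i hi => by
    have h1 := hX ⟨i, hi⟩
    have h2 := hRr ⟨i, hi⟩
    simp only at h1 h2
    rw [h1, h2]
    exact hr' ⟨i, hi⟩
  have hM' : ∀ a b, Spans n k c R a b → b' - a' ≤ b - a := fun a b h =>
    hM.2 a b ((isColorSpanning_iff hc hRr).2 h)
  have hMW : b' - a' ≤ X (n - 1) + 1 - X 0 := by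
    refine hM' _ _ ⟨?_, fun y hy => ?_⟩
    · linarith [hS.mono 0 (n - 1) (Nat.zero_le _) (by omega)]
    · obtain ⟨i, hi⟩ := hsurj ⟨y, hy⟩
      refine ⟨i, i.2, by rw [hc, hi], ?_, ?_⟩
      · exact (hS.mono 0 i (Nat.zero_le _) i.2).trans (hRX i i.2).1
      · linarith [(hRX i i.2).2, hS.mono i (n - 1) (by omega) (by omega)]
  rcases hS.le_of_spans hn hR hL hP hfeas hp
    ((isColorSpanning_iff (r' := fun i => min (p (runFirst c i)) (X i + 1)) hc
      fun i => (hr i).symm).1 hab.1) with h | rfl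
  · exact (hopt _ hMW (hS.feasible_of_spans hRX hR hg hL hP hMW hM')).trans h
  · -- with a single color, each point is a minimum color-spanning interval
    have := hM' (R 0) (R 0) ⟨le_rfl, fun y hy => ⟨0, hn, by
      have := hS.color_lt 0 hn
      omega, le_rfl, le_rfl⟩⟩
    linarith [hab.1.1]

/-! ### The run of the program -/

theorem Seen.init {c seen : ℕ → ℕ} (h : ∀ a, seen a = 0) : Seen c 0 0 seen where
  last a t ht := by
    rw [h] at ht
    omega
  ne_zero i hi := by omega
  card := by simp

theorem Links.init {c nx pr : ℕ → ℕ} {k : ℕ} (hnx : ∀ v, nx v = 0) (hpr : ∀ w, pr w = 0) :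
    Links c k 0 0 nx pr where
  s_le := le_rfl
  cover i hi := by omega
  nx_iff_pr v w := by simp [hnx, hpr]
  sound v w hvw := by
    rw [hnx] at hvw
    omega
  complete t w hw := by omega

theorem Links.lt {c nx pr : ℕ → ℕ} {k n s : ℕ} (h : Links c k n s nx pr) {u w : ℕ}
    (huw : nx u = w + 1) : u < w ∧ w < n := by
  obtain ⟨h1, -, t, rfl, h2⟩ := h.sound u w huw
  exact ⟨(runFirst_le c t).trans_lt h2.lt, h1⟩

attribute [local simp] Program.WritesNat Program.WritesReal upTo orderLoop runsBody linksBody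
  orderBody hullGap hullStep hullBody spreadBody outputBody setWidth initHull initSpread

/-- The program takes linear time and computes data with the properties required by
`isSolution_of_pathOrder`. -/
theorem exists_runs_program : ∃ C : ℕ, ∀ {n k : ℕ} {x : ℕ → ℝ} {c : ℕ → ℕ}, 0 < n →
    Separated n k x c → ∀ m : Memory, m.nat 0 0 = n → m.nat 0 1 = k → m.nat colorArr = c →
    m.real leftArr = x → (∀ a i, 1 < a → m.nat a i = 0) →
    ∃ (t : ℕ) (m' : Memory), Runs program m t m' ∧ t ≤ C * n ∧
      ∃ (f g nx pr ord : ℕ → ℕ) (sh lo up p : ℕ → ℝ) (s : ℕ) (L : ℝ),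
        RunsState c n f g ∧ (∀ v, g v < n) ∧ Links c k n s nx pr ∧
        PathOrder nx g x n ((x (n - 1) + 1 - x 0) + (x (n - 1) + 1 - x 0)) ord sh lo up ∧
        Feasible lo up n L ∧ (∀ M ≤ x (n - 1) + 1 - x 0, Feasible lo up n M → M ≤ L) ∧
        (∀ t < n, p (ord t) = greedy lo L (t + 1) - sh t) ∧
        ∀ i < n, m'.real outArr i = min (p (runFirst c i)) (x i + 1) := by
  refine ⟨4 * ((Test.natLt (nvar runIdx) sizeExpr).cost + 1 + runsBody.bound) +
    4 * ((Test.natLt (nvar winEnd) sizeExpr).cost + 1 + linksBody.bound) + setWidth.bound +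
    4 * ((Test.or (.natLt (.const 0) (nvar walker))
        (.natLt (nvar scanIdx) sizeExpr)).cost + 1 + orderBody.bound) + initHull.bound +
    4 * ((Test.natLt (nvar hullIdx) sizeExpr).cost + 1 + hullBody.bound) + initSpread.bound +
    4 * ((Test.natLt (nvar spreadIdx) sizeExpr).cost + 1 + spreadBody.bound) +
    4 * ((Test.natLt (nvar outIdx) sizeExpr).cost + 1 + outputBody.bound), ?_⟩
  intro n k x c hn hS m hm0 hm1 hmc hmx hz
  obtain ⟨t₁, m₁, r₁, b₁, hR, hg⟩ := exists_runs_runs (c := c) (n := n) (m := m)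
    ⟨hm0, hmc, by simp [hz], by simp [hz, RunsState], by simp [hz, hn]⟩
  have n₁ : ∀ a, ¬ (upTo runIdx runsBody).WritesNat a → m₁.nat a = m.nat a := fun a => r₁.nat_eq
  have e₁ : ∀ a, m₁.real a = m.real a := fun a => r₁.real_eq (by simp)
  simp at n₁
  obtain ⟨t₂, m₂, r₂, b₂, s, hL⟩ := exists_runs_links (c := c) (n := n) (k := k) hS.color_lt
    (m := m₁) ⟨by simp [n₁, hm0], by simp [n₁, hm1], by simp [n₁, hmc], fun t ht => (hR t ht).1,
      by simp [n₁, hz], by simpa [n₁, hz] using Seen.init (by simp [hz]),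
      by simpa [n₁, hz] using Links.init (by simp [hz]) (by simp [hz])⟩
  have n₂ : ∀ a, ¬ (upTo winEnd linksBody).WritesNat a → m₂.nat a = m₁.nat a := fun a => r₂.nat_eq
  have e₂ : ∀ a, m₂.real a = m₁.real a := fun a => r₂.real_eq (by simp)
  simp at n₂
  obtain ⟨t₃, m₃, r₃, b₃, rfl⟩ := Program.wp.exists_runs (p := setWidth) (m := m₂)
    (Q := fun m' => m' = m₂.setReal widthVar 0 (x (n - 1) + 1 - x 0))
    (by simp [n₁, n₂, e₁, e₂, hm0, hmx])
  obtain ⟨t₄, m₄, r₄, b₄, hP⟩ := exists_runs_order hL.nx_iff_pr (fun u w h => hL.lt h) (x := x)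
    (n := n) (g := m₁.nat lastArr) (W := x (n - 1) + 1 - x 0)
    (m := m₂.setReal widthVar 0 (x (n - 1) + 1 - x 0))
    ⟨by simp [n₁, n₂, hm0], by simp, by simp, by simp [n₂], by simp [e₁, e₂, hmx], by simp,
      by simpa [n₁, n₂, hz] using OrderState.init⟩
  have n₄ : ∀ a, ¬ orderLoop.WritesNat a → m₄.nat a = (m₂.setReal widthVar 0 _).nat a :=
    fun a => r₄.nat_eq
  have e₄ : ∀ a, ¬ orderLoop.WritesReal a → m₄.real a = (m₂.setReal widthVar 0 _).real a :=
    fun a => r₄.real_eq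
  simp at n₄ e₄
  obtain ⟨t₅, m₅, r₅, b₅, rfl⟩ := Program.wp.exists_runs (p := initHull) (m := m₄)
    (Q := fun m' => m' = ((m₄.setReal gapVar 0 (x (n - 1) + 1 - x 0)).setNat hullEnd 0 1).setNat
      hullIdx 0 1) (by simp [n₁, n₂, n₄, e₄, hz])
  obtain ⟨t₆, m₆, r₆, b₆, hfeas, hopt⟩ := exists_runs_hull (l := m₄.real lowerArr)
    (u := m₄.real upperArr) (n := n) (W := x (n - 1) + 1 - x 0)
    (m := ((m₄.setReal gapVar 0 (x (n - 1) + 1 - x 0)).setNat hullEnd 0 1).setNat hullIdx 0 1)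
    ⟨by simp [n₁, n₂, n₄, hm0], by simp, by simp, by
      simpa [n₁, n₂, n₄, hz] using Hull.init hn (by simp [hz])⟩ (by simp)
  have n₆ : ∀ a, ¬ (upTo hullIdx hullBody).WritesNat a → m₆.nat a =
    (((m₄.setReal gapVar 0 (x (n - 1) + 1 - x 0)).setNat hullEnd 0 1).setNat hullIdx 0 1).nat a :=
    fun a => r₆.nat_eq
  have e₆ : ∀ a, ¬ (upTo hullIdx hullBody).WritesReal a → m₆.real a =
    (((m₄.setReal gapVar 0 (x (n - 1) + 1 - x 0)).setNat hullEnd 0 1).setNat hullIdx 0 1).real a :=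
    fun a => r₆.real_eq
  simp at n₆ e₆
  obtain ⟨t₇, m₇, r₇, b₇, rfl⟩ := Program.wp.exists_runs (p := initSpread) (m := m₆)
    (Q := fun m' => m' = m₆.setReal positionVar 0 (m₆.real lowerArr 0 - m₆.real gapVar 0)) (by simp)
  obtain ⟨t₈, m₈, r₈, b₈, hp⟩ := exists_runs_spread (ord := m₄.nat orderArr)
    (l := m₄.real lowerArr) (sh := m₄.real shiftArr) (L := m₆.real gapVar 0) (n := n) hP.inj
    (m := m₆.setReal positionVar 0 (m₆.real lowerArr 0 - m₆.real gapVar 0))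
    ⟨by simp [n₁, n₂, n₄, n₆, hm0], by simp [n₆], by simp [e₆], by simp [e₆], by simp,
      by simp [n₁, n₂, n₄, n₆, hz], by simp [n₁, n₂, n₄, n₆, e₆, hz, greedy],
      by simp [n₁, n₂, n₄, n₆, hz]⟩
  have n₈ : ∀ a, ¬ (upTo spreadIdx spreadBody).WritesNat a → m₈.nat a = m₆.nat a :=
    fun a => r₈.nat_eq
  have e₈ : ∀ a, ¬ (upTo spreadIdx spreadBody).WritesReal a → m₈.real a =
    (m₆.setReal positionVar 0 (m₆.real lowerArr 0 - m₆.real gapVar 0)).real a :=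
    fun a => r₈.real_eq
  simp at n₈ e₈
  obtain ⟨t₉, m₉, r₉, b₉, hout⟩ := exists_runs_output (f := m₁.nat firstArr) (x := x)
    (P := m₈.real posArr) (n := n) (m := m₈)
    ⟨by simp [n₁, n₂, n₄, n₆, n₈, hm0], by simp [n₂, n₄, n₆, n₈],
      by simp [e₁, e₂, e₄, e₆, e₈, hmx], rfl, by simp [n₁, n₂, n₄, n₆, n₈, hz],
      by simp [n₁, n₂, n₄, n₆, n₈, hz]⟩
  refine ⟨_, m₉, r₁.seq (r₂.seq (r₃.seq (r₄.seq (r₅.seq (r₆.seq (r₇.seq (r₈.seq r₉))))))), ?_,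
    _, _, _, _, _, _, _, _, _, s, _, hR, hg, hL, hP, hfeas, hopt, hp, fun i hi => ?_⟩
  · have loop : ∀ {t K : ℕ}, t ≤ (2 * n + 2) * K → t ≤ 4 * K * n := fun {t K} h =>
      h.trans (by nlinarith)
    have line : ∀ {t K : ℕ}, t ≤ K → t ≤ K * n := fun h => h.trans (Nat.le_mul_of_pos_right _ hn)
    simp only [Nat.add_mul _ _ n]
    linarith only [loop b₁, loop b₂, line b₃, loop b₄, line b₅, loop b₆, line b₇, loop b₈, loop b₉]
  · rw [hout i hi, (hR i hi).1]

end LMCSI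

theorem theorem2p5 :
    ∃ (prog : RealRAM.Program) (C : ℕ),
      ∀ (n k : ℕ), 0 < n →
        ∀ (x : Fin n → ℝ) (col : Fin n → Fin k),
          Monotone x →
          (∀ i j, col i ≠ col j → Disjoint (LMCSI.unitSeg (x i)) (LMCSI.unitSeg (x j))) →
          ∃ (t : ℕ) (m : RealRAM.Memory),
            RealRAM.Runs prog (LMCSI.input x col) t m ∧ t ≤ C * n ∧
              LMCSI.IsSolution x col (LMCSI.output n m) := by
  obtain ⟨C, hC⟩ := LMCSI.exists_runs_program
  refine ⟨LMCSI.program, C, fun n k hn x col hmono hdisj => ?_⟩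
  have hX : ∀ i : Fin n, (LMCSI.input x col).real 0 i = x i := fun i => by simp [LMCSI.input]
  have hc : ∀ i : Fin n, (LMCSI.input x col).nat 1 i = col i := fun i => by simp [LMCSI.input]
  have hS : LMCSI.Separated n k ((LMCSI.input x col).real 0) ((LMCSI.input x col).nat 1) := by
    refine ⟨fun i hi => ?_, fun i j hij hj => ?_, fun i j hij hj hne => ?_⟩
    · rw [hc ⟨i, hi⟩]
      exact (col ⟨i, hi⟩).2
    · rw [hX ⟨i, by omega⟩, hX ⟨j, hj⟩]
      exact hmono hij
    · rw [hc ⟨i, by omega⟩, hc ⟨j, hj⟩] at hne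
      rw [hX ⟨i, by omega⟩, hX ⟨j, hj⟩]
      have hle : x ⟨i, by omega⟩ ≤ x ⟨j, hj⟩ := hmono hij.le
      by_contra hlt
      -- otherwise, the left endpoint of the right interval lies in both intervals
      exact Set.disjoint_left.1 (hdisj ⟨i, by omega⟩ ⟨j, hj⟩ fun h => hne (by rw [h]))
        ⟨hle, not_lt.1 hlt⟩ ⟨le_rfl, by linarith⟩
  obtain ⟨t, m, hrun, ht, f, g, nx, pr, ord, sh, lo, up, p, s, L, hR, hg, hL, hP, hfeas, hopt, hp,
    hout⟩ := hC hn hS (LMCSI.input x col) (by simp [LMCSI.input]) (by simp [LMCSI.input]) rfl rfl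
      (fun a i ha => by simp [LMCSI.input, show a ≠ 0 by omega, show a ≠ 1 by omega])
  exact ⟨t, m, hrun, ht, LMCSI.isSolution_of_pathOrder hn hX hc hS hR hg hL hP hfeas hopt hp
    fun i => hout i i.2⟩
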